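/- **Setting.** Let $M_1, M_2$ be smooth manifolds (Hausdorff, second countable) of dimensions $k_1,k_2$ with pseudo-Riemannian metrics $\bar g_1,\bar g_2$ and Poisson tensors $\Pi_1,\Pi_2$; let $f_1>0$ and $\nu_1$ be smooth functions on $M_1$. On a manifold with metric $\bar g$ and bivector field $\Pi$ let $\tilde g$ be the cometric, $\|\alpha\|^2=\tilde g(\alpha,\alpha)$ (possibly negative), $\sharp$ the anchor, $\eta(\sharp\omega)=\Pi(\omega,\eta)$, and $J$ the endomorphism of $T^*M$ with $\Pi(\omega,\eta)=\tilde g(J\omega,\eta)$. Let $[\omega,\eta]_\Pi=\mathcal L_{\sharp\omega}\eta-\mathcal L_{\sharp\eta}\omega-d(\Pi(\omega,\eta))$, and let $\mathcal D$ be the contravariant Levi-Civita connection, i.e. the contravariant connection with $\mathcal D_\omega\eta-\mathcal D_\eta\omega=[\omega,\eta]_\Pi$ and $\sharp\omega(\tilde g(\eta,\gamma))=\tilde g(\mathcal D_\omega\eta,\gamma)+\tilde g(\eta,\mathcal D_\omega\gamma)$. Put $\mathcal R(\omega,\eta)\gamma=\mathcal D_\omega\mathcal D_\eta\gamma-\mathcal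 D_\eta\mathcal D_\omega\gamma-\mathcal D_{[\omega,\eta]_\Pi}\gamma$ and $$\mathcal K(\omega,\eta)=\frac{\tilde g(\mathcal R(\omega,\eta)\eta,\omega)}{\tilde g(\omega,\omega)\tilde g(\eta,\eta)-\tilde g(\omega,\eta)^2},\qquad H^u(\omega,\eta)=\tilde g(\mathcal D_\omega J\,du,\eta).$$ With respect to a local orthonormal coframe $(\theta_i)$ put $\Delta u=-\sum_i\big(\sharp\theta_i(\sharp\theta_i(u))-\sharp(\mathcal D_{\theta_i}\theta_i)(u)\big)$. Objects of $M_1$, $M_2$ carry the index $1$, $2$. Let $M=M_1\times M_2$, with projections $\pi_1,\pi_2$, carry the warped metric $\pi_1^*\bar g_1+(f_1\circ\pi_1)^2\pi_2^*\bar g_2$ and the bivector field $\Pi_1+\nu_1\Pi_2$, and let $\mathcal K^M$ be its sectional curvature; write $\omega^h=\pi_1^*\omega$, $\omega^v=\pi_2^*\omega$, and also $h$, $v$ for the pullback of functions. Let $p=(p_1,p_2)\in M$, let $dx_1,\dots,dx_{k_1}$ be a smooth $\tilde g_1$-orthonormal coframe near $p_1$ with $\tilde g_1(dx_i,dx_i)=-1$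 for $i\le q_1$ and $=1$ for $i>q_1$, and $dy_1,\dots,dy_{k_2}$ a smooth $\tilde g_2$-orthonormal coframe near $p_2$ with $\tilde g_2(dy_j,dy_j)=-1$ for $j\le q_2$ and $=1$ for $j>q_2$. (The notation does not mean that the members are closed forms.) The Laplacian $\Delta_1$ is taken with respect to $(dx_i)$. The qualar curvature of $M$ at $p$ is $$\begin{aligned}\mathcal Q(p)=\;&2\sum_{i\le q_1}\sum_{s>q_1}\mathcal K^M(dx_i^h,dx_s^h)+2\sum_{i\le q_1}\sum_{s>q_2}\mathcal K^M(dx_i^h,f_1^h dy_s^v)\\&+2\sum_{i\le q_2}\sum_{s>q_1}\mathcal K^M(f_1^h dy_i^v,dx_s^h)+2\sum_{i\le q_2}\sum_{s>q_2}\mathcal K^M(f_1^h dy_i^v,f_1^h dy_s^v).\end{aligned}$$ **Theorem.** At $p$, $$\begin{aligned} \mathcal Q(p)=\;&2\sum_{i\le q_1}\sum_{s>q_1}\mathcal K^{M_1}(dx_i,dx_s)^h+2(f_1^2\nu_1^2)^h\sum_{i\le q_2}\sum_{s>q_2}\mathcal K^{M_2}(dy_i,dy_s)^v\\ &+\Big(\tfrac{3f_1^4\|d\nu_1\|_1^2}{2}\Big)^h\sum_{i\le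 q_2}\sum_{s>q_2}\big|\tilde g_2(J_2dy_i,dy_s)^v\big|^2-\frac{2q_2}{f_1^h}(\Delta_1f_1)^h+\frac{2k_2}{f_1^h}\sum_{i\le q_1}H_1^{f_1}(dx_i,dx_i)^h\\ &-\frac{4q_2}{(f_1^h)^2}\sum_{i=1}^{k_1}\big|\tilde g_1(J_1df_1,dx_i)^h\big|^2+\frac{4k_2}{(f_1^h)^2}\sum_{i\le q_1}\big|\tilde g_1(J_1df_1,dx_i)^h\big|^2\\ &-\sum_{i\le q_1}\sum_{s>q_2}\frac{(f_1^h)^4}{2}\big|\tilde g_1(d\nu_1,dx_i)^h\big|^2\big(\|J_2dy_s\|_2^2\big)^v-2\sum_{i\le q_2}\sum_{s>q_2}\frac{(\|J_1df_1\|_1^2)^h}{(f_1^h)^2}\\ &-\sum_{s\le q_2}\sum_{i>q_1}\frac{(f_1^h)^4}{2}\big|\tilde g_1(d\nu_1,dx_i)^h\big|^2\big(\|J_2dy_s\|_2^2\big)^v . \end{aligned}$$ -/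

import Mathlib

open scoped Manifold ContDiff Topology Bundle

noncomputable section

namespace ContravariantGeometry

/-! ### Fields on a manifold -/

section Basic

variable {E : Type*} [NormedAddCommGroup E] [NormedSpace ℝ E] [FiniteDimensional ℝ E]
  {H : Type*} [TopologicalSpace H] (I : ModelWithCorners ℝ E H)
  (M : Type*) [TopologicalSpace M] [ChartedSpace H M]

/-- The cotangent space at `x`. -/
abbrev Cotangent {M : Type*} [TopologicalSpace M] [ChartedSpace H M] (x : M) : Type _ :=
  TangentSpace I x →L[ℝ] ℝ

/-- Vector fields (no regularity is built in). -/
abbrev VField : Type _ := Π x : M, TangentSpace I x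

/-- One-forms (no regularity is built in). -/
abbrev OneForm : Type _ := Π x : M, Cotangent I x

/-- Fields of bilinear forms on the tangent spaces. -/
abbrev BilinField : Type _ := Π x : M, TangentSpace I x →L[ℝ] TangentSpace I x →L[ℝ] ℝ

/-- A bivector field `Π`, given by its anchor (sharp) map `♯ : T*M → TM`;
the bivector itself is `Π(α, β) = β (♯ α)`, see `Anchor.pair`. -/
abbrev Anchor : Type _ := Π x : M, Cotangent I x →L[ℝ] TangentSpace I x

/-- A contravariant derivative operator: `D η x α` is the covector `(𝒟_α η)(x)`. -/
abbrev ContraOp : Type _ := OneForm I M → Π x : M, Cotangent I x →L[ℝ] Cotangent I x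

variable {I M}
variable [IsManifold I ∞ M]

/-- `α` is a smooth section of the cotangent bundle in a neighbourhood of `x`. -/
def OneForm.SmoothNear (α : OneForm I M) (x : M) : Prop :=
  ∀ᶠ y in 𝓝 x, ContMDiffAt I (I.prod 𝓘(ℝ, E →L[ℝ] ℝ)) ∞
    (fun z ↦ Bundle.TotalSpace.mk' (E →L[ℝ] ℝ) z (α z)) y

/-- A pseudo-Riemannian metric: a smooth field of symmetric nondegenerate bilinear forms. -/
structure IsPseudoRiemannian (g : BilinField I M) : Prop where
  symm : ∀ x v w, g x v w = g x w v
  nondegenerate : ∀ x v, (∀ w, g x v w = 0) → v = 0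
  smooth : ContMDiff I (I.prod 𝓘(ℝ, E →L[ℝ] E →L[ℝ] ℝ)) ∞
    (fun x ↦ Bundle.TotalSpace.mk' (E →L[ℝ] E →L[ℝ] ℝ) x (g x))

/-- The value `Π(α, β)` of a bivector field on two covectors. -/
def Anchor.pair (P : Anchor I M) (x : M) (α β : Cotangent I x) : ℝ := β (P x α)

/-- The bracket `{u, v} = Π(du, dv)`. -/
def Anchor.bracket (P : Anchor I M) (u v : M → ℝ) : M → ℝ :=
  fun x ↦ P.pair x (mvfderiv I u x) (mvfderiv I v x)

/-- A Poisson tensor: a smooth skew-symmetric bivector field whose Schouten bracket with itself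
vanishes, i.e. whose bracket of functions satisfies the Jacobi identity. -/
structure IsPoisson (P : Anchor I M) : Prop where
  skew : ∀ x α β, P.pair x α β = - P.pair x β α
  smooth : ContMDiff I (I.prod 𝓘(ℝ, (E →L[ℝ] ℝ) →L[ℝ] E)) ∞
    (fun x ↦ Bundle.TotalSpace.mk' ((E →L[ℝ] ℝ) →L[ℝ] E)
      (E := fun x : M ↦ (TangentSpace I x →L[ℝ] ℝ) →L[ℝ] TangentSpace I x) x (P x))
  jacobi : ∀ u v w : M → ℝ, ContMDiff I 𝓘(ℝ, ℝ) ∞ u → ContMDiff I 𝓘(ℝ, ℝ) ∞ v →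
    ContMDiff I 𝓘(ℝ, ℝ) ∞ w → ∀ x,
      P.bracket (P.bracket u v) w x + P.bracket (P.bracket v w) u x
        + P.bracket (P.bracket w u) v x = 0

/-! ### Lie derivative and bracket of one-forms -/

/-- `Y ↦ (ℒ_X η)(Y)(x) = X(η(Y))(x) - η([X, Y])(x)`. -/
def lieDerivEval (X : VField I M) (η : OneForm I M) (x : M) (Y : VField I M) : ℝ :=
  mvfderiv I (fun y ↦ η y (Y y)) x (X x) - η x (VectorField.mlieBracket I X Y x)

/-- If `η` is differentiable at `x` then the value above is tensorial in `Y`. -/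
lemma tensorialAt_lieDerivEval (X : VField I M) (η : OneForm I M) (x : M)
    (hη : MDifferentiableAt I (I.prod 𝓘(ℝ, E →L[ℝ] ℝ))
      (fun z ↦ Bundle.TotalSpace.mk' (E →L[ℝ] ℝ) z (η z)) x) :
    TensorialAt I E (lieDerivEval X η x) x := by
  have key : ∀ σ : VField I M, MDiffAt (T% σ) x →
      MDiffAt (fun y ↦ η y (σ y)) x := by
    intro σ hσ
    have : MDifferentiableAt I (I.prod 𝓘(ℝ, ℝ))
        (fun m ↦ Bundle.TotalSpace.mk' ℝ (E := Bundle.Trivial M ℝ) m (η m (σ m))) x :=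
      MDifferentiableAt.clm_bundle_apply (F₁ := E) (F₂ := ℝ) hη hσ
    simp only [mdifferentiableAt_totalSpace] at this
    exact this.2
  constructor
  · intro f σ hf hσ
    have h1 : (fun y ↦ η y ((f • σ) y)) = f * (fun y ↦ η y (σ y)) := by
      funext y; simp
    simp only [lieDerivEval, h1, mvfderiv_mul hf (key σ hσ),
      VectorField.mlieBracket_smul_right hf hσ]
    simp
    ring
  · intro σ σ' hσ hσ'
    have h1 : (fun y ↦ η y ((σ + σ') y)) = (fun y ↦ η y (σ y)) + (fun y ↦ η y (σ' y)) := by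
      funext y; simp
    simp only [lieDerivEval, h1, mvfderiv_add (key σ hσ) (key σ' hσ'),
      VectorField.mlieBracket_add_right hσ hσ']
    simp
    ring

open Classical in
/-- The Lie derivative `ℒ_X η` at `x`: the covector with `(ℒ_X η)(Y) = X(η(Y)) - η([X, Y])` for
all vector fields `Y` that are differentiable at `x` (it is `0` when there is no such covector,
which does not happen when `η` is differentiable at `x`). -/
def lieDeriv (X : VField I M) (η : OneForm I M) : OneForm I M := fun x ↦
  if h : TensorialAt I E (lieDerivEval X η x) x then TensorialAt.mkHom (lieDerivEval X η x) x h
  else 0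

/-- The bracket `[α, η]_Π = ℒ_{♯α} η - ℒ_{♯η} α - d(Π(α, η))` of one-forms. -/
def formBracket (P : Anchor I M) (α η : OneForm I M) : OneForm I M := fun x ↦
  lieDeriv (fun y ↦ P y (α y)) η x - lieDeriv (fun y ↦ P y (η y)) α x
    - mvfderiv I (fun y ↦ P.pair y (α y) (η y)) x

/-! ### Cometric and the field endomorphism -/

/-- The inverse `♯_g : T*M → TM` of the musical isomorphism `v ↦ g(v, ·)`. -/
def musicalSharp (g : BilinField I M) (x : M) : Cotangent I x →L[ℝ] TangentSpace I x :=
  ContinuousLinearMap.inverse (g x)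

/-- The cometric `g̃(α, β) = g(♯_g α, ♯_g β)`. -/
def cometric (g : BilinField I M) (x : M) (α β : Cotangent I x) : ℝ :=
  g x (musicalSharp g x α) (musicalSharp g x β)

/-- The field endomorphism `J` of `T*M` with `Π(α, β) = g̃(Jα, β)`, namely `Jα = g(♯_Π α, ·)`. -/
def fieldEndo (g : BilinField I M) (P : Anchor I M) (x : M) :
    Cotangent I x →L[ℝ] Cotangent I x :=
  (g x) ∘L (P x)

/-- A nondegenerate bilinear form on a finite-dimensional space is invertible as a map to the
dual space. -/
lemma isInvertible_of_nondegenerate {F : Type*} [NormedAddCommGroup F] [NormedSpace ℝ F]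
    [FiniteDimensional ℝ F] (B : F →L[ℝ] F →L[ℝ] ℝ) (hB : ∀ v, (∀ w, B v w = 0) → v = 0) :
    B.IsInvertible := by
  have hinj : Function.Injective (B : F →ₗ[ℝ] (F →L[ℝ] ℝ)) := by
    rw [← LinearMap.ker_eq_bot, LinearMap.ker_eq_bot']
    intro v hv
    refine hB v fun w ↦ ?_
    have hv' : B v = 0 := hv
    rw [hv']
    rfl
  have hdim : Module.finrank ℝ F = Module.finrank ℝ (F →L[ℝ] ℝ) := by
    rw [← LinearEquiv.finrank_eq (LinearMap.toContinuousLinearMap (𝕜 := ℝ) (E := F) (F' := ℝ))]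
    exact (Subspace.dual_finrank_eq (K := ℝ) (V := F)).symm
  refine ⟨((B : F →ₗ[ℝ] (F →L[ℝ] ℝ)).linearEquivOfInjective hinj
    hdim).toContinuousLinearEquiv, ?_⟩
  ext v w
  rfl

lemma musicalSharp_apply {g : BilinField I M} (hg : IsPseudoRiemannian g) (x : M)
    (α : Cotangent I x) : g x (musicalSharp g x α) = α := by
  have h := isInvertible_of_nondegenerate (F := E) (g x) (hg.nondegenerate x)
  exact h.self_apply_inverse α

lemma cometric_fieldEndo {g : BilinField I M} (hg : IsPseudoRiemannian g) (P : Anchor I M)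
    (x : M) (α β : Cotangent I x) :
    cometric g x (fieldEndo g P x α) β = P.pair x α β := by
  have h := isInvertible_of_nondegenerate (F := E) (g x) (hg.nondegenerate x)
  have h1 : musicalSharp g x (fieldEndo g P x α) = P x α := h.inverse_apply_self (P x α)
  rw [cometric, h1, hg.symm, musicalSharp_apply hg]
  rfl

/-! ### The contravariant Levi-Civita connection and its curvature -/

/-- The one-form `𝒟_α η`. -/
def ContraOp.deriv (D : ContraOp I M) (α η : OneForm I M) : OneForm I M := fun x ↦ D η x (α x)

/-- `D` is the contravariant Levi-Civita connection of `(g̃, Π)`: a contravariant connection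
(it sends smooth forms to smooth forms, `𝒟_α η` is tensorial in `α`, which is part of the type of
`D`, additive in `η` and satisfies the Leibniz rule `𝒟_α (u η) = u 𝒟_α η + (♯α)(u) η`), which
is compatible with the cometric and has vanishing torsion `𝒟_α η - 𝒟_η α - [α, η]_Π`. -/
structure IsLeviCivita (g : BilinField I M) (P : Anchor I M) (D : ContraOp I M) : Prop where
  smooth : ∀ (α η : OneForm I M) (x : M), α.SmoothNear x → η.SmoothNear x →
    (D.deriv α η).SmoothNear x
  add : ∀ (α η γ : OneForm I M) (x : M), α.SmoothNear x → η.SmoothNear x → γ.SmoothNear x →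
    D.deriv α (fun y ↦ η y + γ y) x = D.deriv α η x + D.deriv α γ x
  leibniz : ∀ (α η : OneForm I M) (u : M → ℝ) (x : M), α.SmoothNear x → η.SmoothNear x →
    (∀ᶠ y in 𝓝 x, ContMDiffAt I 𝓘(ℝ, ℝ) ∞ u y) →
    D.deriv α (fun y ↦ u y • η y) x
      = u x • D.deriv α η x + (mvfderiv I u x (P x (α x))) • η x
  metric : ∀ (α η γ : OneForm I M) (x : M), α.SmoothNear x → η.SmoothNear x → γ.SmoothNear x →
    mvfderiv I (fun y ↦ cometric g y (η y) (γ y)) x (P x (α x))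
      = cometric g x (D.deriv α η x) (γ x) + cometric g x (η x) (D.deriv α γ x)
  torsion_free : ∀ (α η : OneForm I M) (x : M), α.SmoothNear x → η.SmoothNear x →
    D.deriv α η x - D.deriv η α x - formBracket P α η x = 0

/-- The curvature `ℛ(α, η)γ = 𝒟_α 𝒟_η γ - 𝒟_η 𝒟_α γ - 𝒟_{[α, η]_Π} γ`. -/
def curvature (P : Anchor I M) (D : ContraOp I M) (α η γ : OneForm I M) : OneForm I M :=
  fun x ↦ D.deriv α (D.deriv η γ) x - D.deriv η (D.deriv α γ) x
    - D.deriv (formBracket P α η) γ x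

/-- The sectional curvature `𝒦(α, η)` at `x`. -/
def sectionalCurvature (g : BilinField I M) (P : Anchor I M) (D : ContraOp I M)
    (α η : OneForm I M) (x : M) : ℝ :=
  cometric g x (curvature P D α η η x) (α x) /
    (cometric g x (α x) (α x) * cometric g x (η x) (η x) - cometric g x (α x) (η x) ^ 2)

/-- The squared length `‖α‖² = g̃(α, α)`, which may be negative. -/
def normSq (g : BilinField I M) (x : M) (α : Cotangent I x) : ℝ := cometric g x α α

/-- The one-form `J du`. -/
def Jd (g : BilinField I M) (P : Anchor I M) (u : M → ℝ) : OneForm I M :=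
  fun y ↦ fieldEndo g P y (mvfderiv I u y)

/-- The Hessian `H^u(α, η) = g̃(𝒟_α (J du), η)`. -/
def hessian (g : BilinField I M) (P : Anchor I M) (D : ContraOp I M) (u : M → ℝ)
    (α η : OneForm I M) (x : M) : ℝ :=
  cometric g x (D.deriv α (Jd g P u) x) (η x)

/-- The second contravariant derivative of a function,
`𝒟²_{α, η} u = 𝒟_α (𝒟_η u) - 𝒟_{𝒟_α η} u`, where `𝒟_α u = (♯α)(u)`. -/
def secondDeriv (P : Anchor I M) (D : ContraOp I M) (u : M → ℝ) (α η : OneForm I M) (x : M) : ℝ :=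
  mvfderiv I (fun y ↦ mvfderiv I u y (P y (η y))) x (P x (α x))
    - mvfderiv I u x (P x (D.deriv α η x))

/-- The contravariant Laplacian `Δ u = - ∑ᵢ 𝒟²_{θᵢ, θᵢ} u` with respect to a coframe `θ`. -/
def laplacian (P : Anchor I M) (D : ContraOp I M) {k : ℕ} (θ : Fin k → OneForm I M)
    (u : M → ℝ) (x : M) : ℝ :=
  - ∑ i, secondDeriv P D u (θ i) (θ i) x

/-- The coframe `θ` is smooth and `g̃`-orthonormal near `x`, its first `q` members being timelike
(square `-1`) and the others spacelike (square `1`). -/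
structure IsOrthonormalCoframe (g : BilinField I M) {k : ℕ} (q : ℕ) (θ : Fin k → OneForm I M)
    (x : M) : Prop where
  smooth : ∀ i, (θ i).SmoothNear x
  timelike : ∀ i, i.val < q → ∀ᶠ y in 𝓝 x, cometric g y (θ i y) (θ i y) = -1
  spacelike : ∀ i, q ≤ i.val → ∀ᶠ y in 𝓝 x, cometric g y (θ i y) (θ i y) = 1
  orthogonal : ∀ i j, i ≠ j → ∀ᶠ y in 𝓝 x, cometric g y (θ i y) (θ j y) = 0

end Basic

section Qualar

/-- Indices of the timelike members of a coframe with `k` members, of index `q`. -/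
def timelikeIdx (k q : ℕ) : Finset (Fin k) := Finset.univ.filter fun i ↦ i.val < q

/-- Indices of the spacelike members of a coframe with `k` members, of index `q`. -/
def spacelikeIdx (k q : ℕ) : Finset (Fin k) := Finset.univ.filter fun i ↦ q ≤ i.val

/-- The qualar curvature at `x`, i.e. twice the sum of the sectional curvatures of the planes
spanned by one timelike and one spacelike member of an orthonormal coframe; here the coframe is
`θ₁, …, θ_{k₁}, φ₁, …, φ_{k₂}`, with `θ₁, …, θ_{q₁}, φ₁, …, φ_{q₂}` timelike. -/
def qualarCurvature {E : Type*} [NormedAddCommGroup E] [NormedSpace ℝ E] [FiniteDimensional ℝ E]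
    {H : Type*} [TopologicalSpace H] {I : ModelWithCorners ℝ E H}
    {M : Type*} [TopologicalSpace M] [ChartedSpace H M] [IsManifold I ∞ M]
    (g : BilinField I M) (P : Anchor I M) (D : ContraOp I M) {k₁ k₂ : ℕ} (q₁ q₂ : ℕ)
    (θ : Fin k₁ → OneForm I M) (φ : Fin k₂ → OneForm I M) (x : M) : ℝ :=
  2 * ∑ i ∈ timelikeIdx k₁ q₁, ∑ s ∈ spacelikeIdx k₁ q₁, sectionalCurvature g P D (θ i) (θ s) x
  + 2 * ∑ i ∈ timelikeIdx k₁ q₁, ∑ s ∈ spacelikeIdx k₂ q₂, sectionalCurvature g P D (θ i) (φ s) x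
  + 2 * ∑ i ∈ timelikeIdx k₂ q₂, ∑ s ∈ spacelikeIdx k₁ q₁, sectionalCurvature g P D (φ i) (θ s) x
  + 2 * ∑ i ∈ timelikeIdx k₂ q₂, ∑ s ∈ spacelikeIdx k₂ q₂, sectionalCurvature g P D (φ i) (φ s) x

end Qualar

/-! ### Contravariant warped products -/

section Warped

variable {E₁ : Type*} [NormedAddCommGroup E₁] [NormedSpace ℝ E₁] [FiniteDimensional ℝ E₁]
  {H₁ : Type*} [TopologicalSpace H₁] {I₁ : ModelWithCorners ℝ E₁ H₁}
  {M₁ : Type*} [TopologicalSpace M₁] [ChartedSpace H₁ M₁]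
  {E₂ : Type*} [NormedAddCommGroup E₂] [NormedSpace ℝ E₂] [FiniteDimensional ℝ E₂]
  {H₂ : Type*} [TopologicalSpace H₂] {I₂ : ModelWithCorners ℝ E₂ H₂}
  {M₂ : Type*} [TopologicalSpace M₂] [ChartedSpace H₂ M₂]

/-- The differential of the projection `π₁ : M₁ × M₂ → M₁` at `p`. -/
def dproj₁ (p : M₁ × M₂) : TangentSpace (I₁.prod I₂) p →L[ℝ] TangentSpace I₁ p.1 :=
  mfderiv (I₁.prod I₂) I₁ Prod.fst p

/-- The differential of the projection `π₂ : M₁ × M₂ → M₂` at `p`. -/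
def dproj₂ (p : M₁ × M₂) : TangentSpace (I₁.prod I₂) p →L[ℝ] TangentSpace I₂ p.2 :=
  mfderiv (I₁.prod I₂) I₂ Prod.snd p

/-- The horizontal lift of tangent vectors of `M₁` to `p`, i.e. the differential of
`y ↦ (y, p₂)`. -/
def hliftVec (p : M₁ × M₂) : TangentSpace I₁ p.1 →L[ℝ] TangentSpace (I₁.prod I₂) p :=
  mfderiv I₁ (I₁.prod I₂) (fun y ↦ (y, p.2)) p.1

/-- The vertical lift of tangent vectors of `M₂` to `p`, i.e. the differential of
`y ↦ (p₁, y)`. -/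
def vliftVec (p : M₁ × M₂) : TangentSpace I₂ p.2 →L[ℝ] TangentSpace (I₁.prod I₂) p :=
  mfderiv I₂ (I₁.prod I₂) (fun y ↦ (p.1, y)) p.2

/-- The horizontal lift `α^h = π₁^* α` of a one-form. -/
def hlift (α : OneForm I₁ M₁) : OneForm (I₁.prod I₂) (M₁ × M₂) :=
  fun p ↦ (α p.1) ∘L (dproj₁ p)

/-- The vertical lift `α^v = π₂^* α` of a one-form. -/
def vlift (α : OneForm I₂ M₂) : OneForm (I₁.prod I₂) (M₁ × M₂) :=
  fun p ↦ (α p.2) ∘L (dproj₂ p)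

/-- The warped metric `π₁^* g₁ + (f ∘ π₁)² π₂^* g₂`. -/
def warpedMetric (f : M₁ → ℝ) (g₁ : BilinField I₁ M₁) (g₂ : BilinField I₂ M₂) :
    BilinField (I₁.prod I₂) (M₁ × M₂) :=
  fun p ↦ (ContinuousLinearMap.precomp ℝ (dproj₁ p)) ∘L (g₁ p.1) ∘L (dproj₁ p)
    + (f p.1) ^ 2 • (ContinuousLinearMap.precomp ℝ (dproj₂ p)) ∘L (g₂ p.2) ∘L (dproj₂ p)

/-- The warped bivector field `Π₁ + ν Π₂`, as an anchor. -/
def warpedBivector (ν : M₁ → ℝ) (P₁ : Anchor I₁ M₁) (P₂ : Anchor I₂ M₂) :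
    Anchor (I₁.prod I₂) (M₁ × M₂) :=
  fun p ↦ (hliftVec p) ∘L (P₁ p.1) ∘L (ContinuousLinearMap.precomp ℝ (hliftVec p))
    + ν p.1 • (vliftVec p) ∘L (P₂ p.2) ∘L (ContinuousLinearMap.precomp ℝ (vliftVec p))

/-- The one-form `f^h α^v`. -/
def scaledVlift (f : M₁ → ℝ) (α : OneForm I₂ M₂) : OneForm (I₁.prod I₂) (M₁ × M₂) :=
  fun p ↦ f p.1 • vlift (I₁ := I₁) α p

end Warped

end ContravariantGeometry

end

open ContravariantGeometry

noncomputable section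

set_option linter.unusedSectionVars false

namespace ContravariantGeometry

section OneManifold

variable {E : Type*} [NormedAddCommGroup E] [NormedSpace ℝ E] [FiniteDimensional ℝ E]
  {H : Type*} [TopologicalSpace H] {I : ModelWithCorners ℝ E H}
  {M : Type*} [TopologicalSpace M] [ChartedSpace H M] [IsManifold I ∞ M]

lemma OneForm.SmoothNear.contMDiffAt {α : OneForm I M} {x : M} (h : α.SmoothNear x) :
    ContMDiffAt I (I.prod 𝓘(ℝ, E →L[ℝ] ℝ)) ∞
      (fun z ↦ Bundle.TotalSpace.mk' (E →L[ℝ] ℝ) z (α z)) x :=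
  h.self_of_nhds

lemma OneForm.SmoothNear.mdifferentiableAt {α : OneForm I M} {x : M} (h : α.SmoothNear x) :
    MDifferentiableAt I (I.prod 𝓘(ℝ, E →L[ℝ] ℝ))
      (fun z ↦ Bundle.TotalSpace.mk' (E →L[ℝ] ℝ) z (α z)) x :=
  h.contMDiffAt.mdifferentiableAt (by simp)

lemma OneForm.SmoothNear.eventually {α : OneForm I M} {x : M} (h : α.SmoothNear x) :
    ∀ᶠ y in 𝓝 x, α.SmoothNear y :=
  eventually_eventually_nhds.mpr h

/-- A one-form evaluated on a vector field, both differentiable. -/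
lemma mdifferentiableAt_form_apply {α : OneForm I M} {Y : VField I M} {x : M}
    (hα : MDifferentiableAt I (I.prod 𝓘(ℝ, E →L[ℝ] ℝ))
      (fun z ↦ Bundle.TotalSpace.mk' (E →L[ℝ] ℝ) z (α z)) x) (hY : MDiffAt (T% Y) x) :
    MDiffAt (fun y ↦ α y (Y y)) x := by
  have : MDifferentiableAt I (I.prod 𝓘(ℝ, ℝ))
      (fun m ↦ Bundle.TotalSpace.mk' ℝ (E := Bundle.Trivial M ℝ) m (α m (Y m))) x :=
    MDifferentiableAt.clm_bundle_apply (F₁ := E) (F₂ := ℝ) hα hY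
  simp only [mdifferentiableAt_totalSpace] at this
  exact this.2

lemma contMDiffAt_anchor_apply {P : Anchor I M} (hP : IsPoisson P) {α : OneForm I M} {x : M}
    (hα : α.SmoothNear x) : ContMDiffAt I (I.prod 𝓘(ℝ, E)) ∞ (T% (fun y ↦ P y (α y))) x :=
  ContMDiffAt.clm_bundle_apply (F₁ := E →L[ℝ] ℝ) (F₂ := E)
    (E₁ := fun x : M ↦ TangentSpace I x →L[ℝ] ℝ) (E₂ := fun x : M ↦ TangentSpace I x)
    (hP.smooth x) hα.contMDiffAt

lemma mdifferentiableAt_anchor_apply {P : Anchor I M} (hP : IsPoisson P) {α : OneForm I M} {x : M}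
    (hα : α.SmoothNear x) : MDiffAt (T% (fun y ↦ P y (α y))) x :=
  (contMDiffAt_anchor_apply hP hα).mdifferentiableAt (by simp)

/-- Every covector is the value of a one-form that is smooth nearby. -/
lemma exists_smoothNear (x : M) (ξ : Cotangent I x) :
    ∃ α : OneForm I M, α.SmoothNear x ∧ α x = ξ := by
  refine ⟨FiberBundle.extend (E →L[ℝ] ℝ) (E := fun x : M ↦ (TangentSpace I x →L[ℝ] ℝ)) ξ, ?_,
    FiberBundle.extend_apply_self (E →L[ℝ] ℝ) (E := fun x : M ↦ (TangentSpace I x →L[ℝ] ℝ)) ξ⟩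
  obtain ⟨s, hs, h⟩ := FiberBundle.exists_contMDiffOn_extend (k := ∞) I (E →L[ℝ] ℝ)
    (V := fun x : M ↦ (TangentSpace I x →L[ℝ] ℝ)) ξ
  filter_upwards [eventually_mem_nhds_iff.mpr hs] with y hy
  exact h.contMDiffAt hy

/-- Every tangent vector is the value of a vector field that is differentiable there. -/
lemma exists_vectorField (x : M) (v : TangentSpace I x) :
    ∃ Y : VField I M, MDiffAt (T% Y) x ∧ Y x = v :=
  ⟨FiberBundle.extend E (E := fun x : M ↦ TangentSpace I x) v,
    FiberBundle.mdifferentiableAt_extend I E (V := fun x : M ↦ TangentSpace I x) v,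
    FiberBundle.extend_apply_self E (E := fun x : M ↦ TangentSpace I x) v⟩

/-- The differential of a smooth function is a smooth one-form. -/
lemma smoothNear_mvfderiv {u : M → ℝ} {x : M}
    (hu : ∀ᶠ y in 𝓝 x, ContMDiffAt I 𝓘(ℝ, ℝ) ∞ u y) :
    OneForm.SmoothNear (fun y ↦ mvfderiv I u y : OneForm I M) x := by
  filter_upwards [hu] with y hy
  rw [contMDiffAt_hom_bundle]
  refine ⟨contMDiffAt_id, ?_⟩
  have h := ContMDiffAt.mfderiv_const (m := ∞) hy (by simp)
  refine h.congr_of_eventuallyEq (Filter.Eventually.of_forall fun z ↦ ?_)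
  ext v
  simp [inTangentCoordinates, ContinuousLinearMap.inCoordinates, mvfderiv]
  rfl

lemma smoothNear_Jd {g : BilinField I M} (hg : IsPseudoRiemannian g) {P : Anchor I M}
    (hP : IsPoisson P) {u : M → ℝ} {x : M}
    (hu : ∀ᶠ y in 𝓝 x, ContMDiffAt I 𝓘(ℝ, ℝ) ∞ u y) : (Jd g P u).SmoothNear x := by
  filter_upwards [(smoothNear_mvfderiv hu).eventually] with y hy
  exact ContMDiffAt.clm_bundle_apply (F₁ := E) (F₂ := E →L[ℝ] ℝ)
    (E₁ := fun x : M ↦ TangentSpace I x) (E₂ := fun x : M ↦ TangentSpace I x →L[ℝ] ℝ)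
    (hg.smooth y) (contMDiffAt_anchor_apply hP hy)

/-! ### The cometric -/

lemma cometric_eq_apply {g : BilinField I M} (hg : IsPseudoRiemannian g) (x : M)
    (α β : Cotangent I x) : cometric g x α β = α (musicalSharp g x β) := by
  rw [cometric, musicalSharp_apply hg]

lemma cometric_comm {g : BilinField I M} (hg : IsPseudoRiemannian g) (x : M)
    (α β : Cotangent I x) : cometric g x α β = cometric g x β α :=
  hg.symm _ _ _

omit [FiniteDimensional ℝ E] [IsManifold I ∞ M]

@[simp] lemma cometric_add_left (g : BilinField I M) (x : M) (α β γ : Cotangent I x) :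
    cometric g x (α + β) γ = cometric g x α γ + cometric g x β γ := by
  simp [cometric]

@[simp] lemma cometric_add_right (g : BilinField I M) (x : M) (α β γ : Cotangent I x) :
    cometric g x γ (α + β) = cometric g x γ α + cometric g x γ β := by
  simp [cometric]

@[simp] lemma cometric_sub_left (g : BilinField I M) (x : M) (α β γ : Cotangent I x) :
    cometric g x (α - β) γ = cometric g x α γ - cometric g x β γ := by
  simp [cometric]

@[simp] lemma cometric_sub_right (g : BilinField I M) (x : M) (α β γ : Cotangent I x) :
    cometric g x γ (α - β) = cometric g x γ α - cometric g x γ β := by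
  simp [cometric]

@[simp] lemma cometric_smul_left (g : BilinField I M) (x : M) (c : ℝ) (α γ : Cotangent I x) :
    cometric g x (c • α) γ = c * cometric g x α γ := by
  simp [cometric]

@[simp] lemma cometric_smul_right (g : BilinField I M) (x : M) (c : ℝ) (α γ : Cotangent I x) :
    cometric g x γ (c • α) = c * cometric g x γ α := by
  simp [cometric]

@[simp] lemma cometric_zero_left (g : BilinField I M) (x : M) (γ : Cotangent I x) :
    cometric g x 0 γ = 0 := by
  simp [cometric]

@[simp] lemma cometric_zero_right (g : BilinField I M) (x : M) (γ : Cotangent I x) :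
    cometric g x γ 0 = 0 := by
  simp [cometric]

end OneManifold

section LeviCivita

variable {E : Type*} [NormedAddCommGroup E] [NormedSpace ℝ E] [FiniteDimensional ℝ E]
  {H : Type*} [TopologicalSpace H] {I : ModelWithCorners ℝ E H}
  {M : Type*} [TopologicalSpace M] [ChartedSpace H M] [IsManifold I ∞ M]

lemma cometric_nondegenerate {g : BilinField I M} (hg : IsPseudoRiemannian g) {x : M}
    {α : Cotangent I x} (h : ∀ β, cometric g x α β = 0) : α = 0 := by
  ext v
  have hinv := isInvertible_of_nondegenerate (F := E) (g x) (hg.nondegenerate x)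
  have h1 : musicalSharp g x (g x v) = v := hinv.inverse_apply_self v
  rw [← h1, ← cometric_eq_apply hg, h]
  rfl

/-- The inverse musical isomorphism of a pseudo-Riemannian metric is smooth. -/
lemma contMDiffAt_musicalSharp_apply {g : BilinField I M} (hg : IsPseudoRiemannian g)
    {α : OneForm I M} {x : M} (hα : α.SmoothNear x) :
    ContMDiffAt I (I.prod 𝓘(ℝ, E)) ∞ (T% (fun y ↦ musicalSharp g y (α y))) x := by
  have h1 := ((contMDiffAt_hom_bundle _).mp (hg.smooth x)).2
  have h2 : ContMDiffAt I 𝓘(ℝ, (E →L[ℝ] ℝ) →L[ℝ] E) ∞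
      (fun y : M ↦ ContinuousLinearMap.inCoordinates (E →L[ℝ] ℝ)
        (fun y : M ↦ TangentSpace I y →L[ℝ] ℝ) E (fun y : M ↦ TangentSpace I y) x y x y
        (musicalSharp g y)) x := by
    have h3 : ContMDiffAt I 𝓘(ℝ, (E →L[ℝ] ℝ) →L[ℝ] E) ∞
        (ContinuousLinearMap.inverse ∘ fun y : M ↦ ContinuousLinearMap.inCoordinates E
          (fun y : M ↦ TangentSpace I y) (E →L[ℝ] ℝ) (fun y : M ↦ TangentSpace I y →L[ℝ] ℝ)
          x y x y (g y)) x := by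
      refine ContMDiffAt.comp x (ContDiffAt.contMDiffAt ?_) h1
      apply ContinuousLinearMap.IsInvertible.contDiffAt_map_inverse
      rw [ContinuousLinearMap.inCoordinates_eq (FiberBundle.mem_baseSet_trivializationAt' x)
        (FiberBundle.mem_baseSet_trivializationAt' x)]
      exact ContinuousLinearMap.isInvertible_equiv.comp
        ((isInvertible_of_nondegenerate (F := E) (g x) (hg.nondegenerate x)).comp
          ContinuousLinearMap.isInvertible_equiv)
    refine h3.congr_of_eventuallyEq ?_
    have A : (trivializationAt E (fun y : M ↦ TangentSpace I y) x).baseSet ∈ 𝓝 x :=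
      (trivializationAt _ _ _).open_baseSet.mem_nhds (FiberBundle.mem_baseSet_trivializationAt' _)
    have B : (trivializationAt (E →L[ℝ] ℝ)
        (fun y : M ↦ TangentSpace I y →L[ℝ] ℝ) x).baseSet ∈ 𝓝 x :=
      (trivializationAt _ _ _).open_baseSet.mem_nhds (FiberBundle.mem_baseSet_trivializationAt' _)
    filter_upwards [A, B] with y hy hy'
    simp only [Function.comp_apply]
    rw [ContinuousLinearMap.inCoordinates_eq hy hy', ContinuousLinearMap.inCoordinates_eq hy' hy]
    simp only [ContinuousLinearMap.inverse_equiv_comp, ContinuousLinearMap.inverse_comp_equiv,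
      ContinuousLinearEquiv.symm_symm, musicalSharp]
    rfl
  exact ContMDiffAt.clm_apply_of_inCoordinates h2 hα.contMDiffAt contMDiffAt_id

/-- The cometric of two smooth one-forms is differentiable. -/
lemma mdifferentiableAt_cometric {g : BilinField I M} (hg : IsPseudoRiemannian g)
    {α β : OneForm I M} {x : M} (hα : α.SmoothNear x) (hβ : β.SmoothNear x) :
    MDiffAt (fun y ↦ cometric g y (α y) (β y)) x := by
  simp only [cometric_eq_apply hg]
  exact mdifferentiableAt_form_apply hα.mdifferentiableAt
    ((contMDiffAt_musicalSharp_apply hg hβ).mdifferentiableAt (by simp))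

/-- Evaluation of the bracket of one-forms on a vector field. -/
lemma formBracket_apply (P : Anchor I M) {α η : OneForm I M} {x : M} (hα : α.SmoothNear x)
    (hη : η.SmoothNear x) {Y : VField I M} (hY : MDiffAt (T% Y) x) :
    formBracket P α η x (Y x) = lieDerivEval (fun y ↦ P y (α y)) η x Y
      - lieDerivEval (fun y ↦ P y (η y)) α x Y
      - mvfderiv I (fun y ↦ P.pair y (α y) (η y)) x (Y x) := by
  have h1 := tensorialAt_lieDerivEval (fun y ↦ P y (α y)) η x hη.mdifferentiableAt
  have h2 := tensorialAt_lieDerivEval (fun y ↦ P y (η y)) α x hα.mdifferentiableAt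
  have e1 : lieDeriv (fun y ↦ P y (α y)) η x (Y x)
      = lieDerivEval (fun y ↦ P y (α y)) η x Y := by
    rw [lieDeriv, dif_pos h1]
    exact TensorialAt.mkHom_apply h1 hY
  have e2 : lieDeriv (fun y ↦ P y (η y)) α x (Y x)
      = lieDerivEval (fun y ↦ P y (η y)) α x Y := by
    rw [lieDeriv, dif_pos h2]
    exact TensorialAt.mkHom_apply h2 hY
  simp only [formBracket, sub_apply, e1, e2]

lemma IsLeviCivita.deriv_sub {g : BilinField I M} {P : Anchor I M} {D : ContraOp I M}
    (hD : IsLeviCivita g P D) {α η : OneForm I M} {x : M} (hα : α.SmoothNear x)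
    (hη : η.SmoothNear x) : D.deriv α η x - D.deriv η α x = formBracket P α η x :=
  sub_eq_zero.mp (hD.torsion_free α η x hα hη)

lemma IsLeviCivita.formBracket_swap {g : BilinField I M} {P : Anchor I M} {D : ContraOp I M}
    (hD : IsLeviCivita g P D) {α η : OneForm I M} {x : M} (hα : α.SmoothNear x)
    (hη : η.SmoothNear x) : formBracket P η α x = - formBracket P α η x := by
  rw [← hD.deriv_sub hα hη, ← hD.deriv_sub hη hα, neg_sub]

/-- The Koszul formula. -/
lemma IsLeviCivita.koszul {g : BilinField I M} {P : Anchor I M} {D : ContraOp I M}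
    (hD : IsLeviCivita g P D) (hg : ∀ x v w, g x v w = g x w v) {α η γ : OneForm I M} {x : M}
    (hα : α.SmoothNear x) (hη : η.SmoothNear x) (hγ : γ.SmoothNear x) :
    2 * cometric g x (D.deriv α η x) (γ x)
      = mvfderiv I (fun y ↦ cometric g y (η y) (γ y)) x (P x (α x))
      + mvfderiv I (fun y ↦ cometric g y (γ y) (α y)) x (P x (η x))
      - mvfderiv I (fun y ↦ cometric g y (α y) (η y)) x (P x (γ x))
      + cometric g x (formBracket P α η x) (γ x)
      - cometric g x (formBracket P α γ x) (η x)
      - cometric g x (formBracket P η γ x) (α x) := by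
  have comm : ∀ β β' : Cotangent I x, cometric g x β β' = cometric g x β' β :=
    fun β β' ↦ hg _ _ _
  rw [hD.metric α η γ x hα hη hγ, hD.metric η γ α x hη hγ hα, hD.metric γ α η x hγ hα hη,
    ← hD.deriv_sub hα hη, ← hD.deriv_sub hα hγ, ← hD.deriv_sub hη hγ]
  simp only [cometric_sub_left]
  rw [comm (η x), comm (γ x), comm (α x) (D.deriv γ η x)]
  ring

/-- The numerator of the sectional curvature, by metric compatibility. -/
lemma IsLeviCivita.cometric_curvature {g : BilinField I M} {P : Anchor I M} {D : ContraOp I M}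
    (hD : IsLeviCivita g P D) {α η : OneForm I M} {x : M}
    (hα : α.SmoothNear x) (hη : η.SmoothNear x) :
    cometric g x (curvature P D α η η x) (α x)
      = mvfderiv I (fun y ↦ cometric g y (D.deriv η η y) (α y)) x (P x (α x))
      - cometric g x (D.deriv η η x) (D.deriv α α x)
      - mvfderiv I (fun y ↦ cometric g y (D.deriv α η y) (α y)) x (P x (η x))
      + cometric g x (D.deriv α η x) (D.deriv η α x)
      - cometric g x (D η x (formBracket P α η x)) (α x) := by
  rw [hD.metric α _ α x hα (hD.smooth η η x hη hη) hα,
    hD.metric η _ α x hη (hD.smooth α η x hα hη) hα]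
  simp only [curvature, cometric_sub_left]
  rw [show D.deriv (formBracket P α η) η x = D η x (formBracket P α η x) from rfl]
  ring

end LeviCivita

section Related

variable {E : Type*} [NormedAddCommGroup E] [NormedSpace ℝ E] [FiniteDimensional ℝ E]
  {H : Type*} [TopologicalSpace H] {I : ModelWithCorners ℝ E H}
  {M : Type*} [TopologicalSpace M] [ChartedSpace H M] [IsManifold I ∞ M]
  {E' : Type*} [NormedAddCommGroup E'] [NormedSpace ℝ E'] [FiniteDimensional ℝ E']
  {H' : Type*} [TopologicalSpace H'] {I' : ModelWithCorners ℝ E' H'}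
  {M' : Type*} [TopologicalSpace M'] [ChartedSpace H' M'] [IsManifold I' ∞ M']

/-- Lie brackets in vector spaces of fields that are related by a linear map. -/
lemma map_lieBracketWithin_univ (L : E →L[ℝ] E') {V W : E → E} {V' W' : E' → E'} {z : E} {z' : E'}
    (hz : L z = z') (hV : DifferentiableAt ℝ V z) (hW : DifferentiableAt ℝ W z)
    (hV' : DifferentiableAt ℝ V' z') (hW' : DifferentiableAt ℝ W' z')
    (hVV : ∀ᶠ y in 𝓝 z, L (V y) = V' (L y)) (hWW : ∀ᶠ y in 𝓝 z, L (W y) = W' (L y)) :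
    L (VectorField.lieBracketWithin ℝ V W Set.univ z)
      = VectorField.lieBracketWithin ℝ V' W' Set.univ z' := by
  subst hz
  have key : ∀ {X : E → E} {X' : E' → E'}, DifferentiableAt ℝ X z →
      DifferentiableAt ℝ X' (L z) → (∀ᶠ y in 𝓝 z, L (X y) = X' (L y)) →
      ∀ u, L (fderiv ℝ X z u) = fderiv ℝ X' (L z) (L u) := by
    intro X X' hX hX' h u
    have h1 : HasFDerivAt (fun y ↦ L (X y)) (L.comp (fderiv ℝ X z)) z :=
      L.hasFDerivAt.comp z hX.hasFDerivAt
    have h2 : HasFDerivAt (X' ∘ L) ((fderiv ℝ X' (L z)).comp L) z :=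
      hX'.hasFDerivAt.comp z L.hasFDerivAt
    exact congrArg (fun A ↦ A u) (h1.unique (h2.congr_of_eventuallyEq h))
  rw [VectorField.lieBracketWithin_univ, VectorField.lieBracketWithin_univ,
    VectorField.lieBracket, VectorField.lieBracket, map_sub, key hW hW' hWW,
    key hV hV' hVV, hVV.self_of_nhds, hWW.self_of_nhds]

lemma differentiableAt_mpullbackWithin_extChartAt_symm [I.Boundaryless] {X : VField I M} {p : M}
    (hX : MDiffAt (T% X) p) :
    DifferentiableAt ℝ (VectorField.mpullbackWithin 𝓘(ℝ, E) I (extChartAt I p).symm X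
      (Set.range I)) (extChartAt I p p) := by
  have := (mdifferentiableWithinAt_univ.mpr hX).differentiableWithinAt_mpullbackWithin_vectorField
  rw [Set.preimage_univ, Set.univ_inter] at this
  exact this.differentiableAt (by
    rw [ModelWithCorners.Boundaryless.range_eq_univ]; exact Filter.univ_mem)

/-- If vector fields are related by a map that is linear in the preferred charts, then so are their
Lie brackets. -/
lemma mfderiv_mlieBracket_of_related [I.Boundaryless] [I'.Boundaryless] {φ : M → M'}
    {V W : VField I M} {V' W' : VField I' M'} {p : M} (L : E →L[ℝ] E')
    (hφ : ∀ x, MDifferentiableAt I I' φ x)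
    (hchart : extChartAt I' (φ p) ∘ φ = L ∘ extChartAt I p)
    (hsymm : φ ∘ (extChartAt I p).symm = (extChartAt I' (φ p)).symm ∘ L)
    (htarget : Set.MapsTo L (extChartAt I p).target (extChartAt I' (φ p)).target)
    (hV : MDiffAt (T% V) p) (hW : MDiffAt (T% W) p)
    (hV' : MDiffAt (T% V') (φ p)) (hW' : MDiffAt (T% W') (φ p))
    (hVV : ∀ᶠ q in 𝓝 p, mfderiv I I' φ q (V q) = V' (φ q))
    (hWW : ∀ᶠ q in 𝓝 p, mfderiv I I' φ q (W q) = W' (φ q)) :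
    mfderiv I I' φ p (VectorField.mlieBracket I V W p)
      = VectorField.mlieBracket I' V' W' (φ p) := by
  have hr : Set.range I = Set.univ := ModelWithCorners.Boundaryless.range_eq_univ
  have hr' : Set.range I' = Set.univ := ModelWithCorners.Boundaryless.range_eq_univ
  have key : ∀ (X : VField I M) (X' : VField I' M'),
      (∀ᶠ q in 𝓝 p, mfderiv I I' φ q (X q) = X' (φ q)) →
      ∀ᶠ z in 𝓝 (extChartAt I p p),
        L (VectorField.mpullbackWithin 𝓘(ℝ, E) I (extChartAt I p).symm X (Set.range I) z)
        = VectorField.mpullbackWithin 𝓘(ℝ, E') I' (extChartAt I' (φ p)).symm X'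
          (Set.range I') (L z) := by
    intro X X' hX
    have hcont : ContinuousAt (extChartAt I p).symm (extChartAt I p p) :=
      continuousAt_extChartAt_symm p
    have hX' : ∀ᶠ q in 𝓝 ((extChartAt I p).symm (extChartAt I p p)),
        mfderiv I I' φ q (X q) = X' (φ q) := by
      rwa [extChartAt_to_inv]
    filter_upwards [hcont.eventually hX', extChartAt_target_mem_nhds p] with z hz hzt
    have hzt' := htarget hzt
    have hA := isInvertible_mfderivWithin_extChartAt_symm hzt
    have hA' := isInvertible_mfderivWithin_extChartAt_symm hzt'
    have hd : MDifferentiableAt 𝓘(ℝ, E) I (extChartAt I p).symm z :=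
      ((contMDiffOn_extChartAt_symm (n := 1) p).contMDiffAt
        ((isOpen_extChartAt_target p).mem_nhds hzt)).mdifferentiableAt one_ne_zero
    have hd' : MDifferentiableAt 𝓘(ℝ, E') I' (extChartAt I' (φ p)).symm (L z) :=
      ((contMDiffOn_extChartAt_symm (n := 1) (φ p)).contMDiffAt
        ((isOpen_extChartAt_target (φ p)).mem_nhds hzt')).mdifferentiableAt one_ne_zero
    simp only [VectorField.mpullbackWithin_apply]
    have hrel : ∀ u, mfderiv I I' φ ((extChartAt I p).symm z)
        (mfderivWithin 𝓘(ℝ, E) I (extChartAt I p).symm (Set.range I) z u)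
        = mfderivWithin 𝓘(ℝ, E') I' (extChartAt I' (φ p)).symm (Set.range I') (L z) (L u) := by
      intro u
      have h1 : HasMFDerivAt 𝓘(ℝ, E) I' (φ ∘ (extChartAt I p).symm) z
          ((mfderiv I I' φ ((extChartAt I p).symm z)).comp
            (mfderiv 𝓘(ℝ, E) I (extChartAt I p).symm z)) :=
        HasMFDerivAt.comp z (hφ _).hasMFDerivAt hd.hasMFDerivAt
      have h2 : HasMFDerivAt 𝓘(ℝ, E) I' ((extChartAt I' (φ p)).symm ∘ L) z
          ((mfderiv 𝓘(ℝ, E') I' (extChartAt I' (φ p)).symm (L z)).comp L) :=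
        HasMFDerivAt.comp z hd'.hasMFDerivAt L.hasMFDerivAt
      have h3 : HasMFDerivAt 𝓘(ℝ, E) I' (φ ∘ (extChartAt I p).symm) z
          ((mfderiv 𝓘(ℝ, E') I' (extChartAt I' (φ p)).symm (L z)).comp L) :=
        h2.congr_of_eventuallyEq (Filter.Eventually.of_forall fun y ↦ congrFun hsymm y)
      simp only [hr, hr', mfderivWithin_univ]
      exact congrArg (fun A ↦ A u) (hasMFDerivAt_unique h1 h3)
    have e1 := hrel ((mfderivWithin 𝓘(ℝ, E) I (extChartAt I p).symm
          (Set.range I) z).inverse (X ((extChartAt I p).symm z)))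
    rw [hA.self_apply_inverse, hz] at e1
    have e2 := congrArg (mfderivWithin 𝓘(ℝ, E') I' (extChartAt I' (φ p)).symm
      (Set.range I') (L z)).inverse e1
    have e3 : φ ((extChartAt I p).symm z) = (extChartAt I' (φ p)).symm (L z) := congrFun hsymm z
    rw [e3] at e2
    exact (e2.trans (hA'.inverse_apply_self _)).symm
  have hbase : ∀ w, mfderiv I I' φ p ((mfderiv I 𝓘(ℝ, E) (extChartAt I p) p).inverse w)
      = (mfderiv I' 𝓘(ℝ, E') (extChartAt I' (φ p)) (φ p)).inverse (L w) := by
    intro w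
    have hA := isInvertible_mfderiv_extChartAt (I := I) (mem_extChartAt_source p)
    have hA' := isInvertible_mfderiv_extChartAt (I := I') (mem_extChartAt_source (φ p))
    have hd : MDifferentiableAt I 𝓘(ℝ, E) (extChartAt I p) p :=
      mdifferentiableAt_extChartAt (mem_chart_source _ p)
    have hd' : MDifferentiableAt I' 𝓘(ℝ, E') (extChartAt I' (φ p)) (φ p) :=
      mdifferentiableAt_extChartAt (mem_chart_source _ (φ p))
    have h1 : HasMFDerivAt I 𝓘(ℝ, E') (L ∘ extChartAt I p) p
        (L.comp (mfderiv I 𝓘(ℝ, E) (extChartAt I p) p)) :=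
      HasMFDerivAt.comp p L.hasMFDerivAt hd.hasMFDerivAt
    have h2 : HasMFDerivAt I 𝓘(ℝ, E') (extChartAt I' (φ p) ∘ φ) p
        ((mfderiv I' 𝓘(ℝ, E') (extChartAt I' (φ p)) (φ p)).comp (mfderiv I I' φ p)) :=
      HasMFDerivAt.comp p hd'.hasMFDerivAt (hφ p).hasMFDerivAt
    rw [← hchart] at h1
    have h4 := congrArg (fun A ↦ A ((mfderiv I 𝓘(ℝ, E) (extChartAt I p) p).inverse w))
      (hasMFDerivAt_unique h2 h1)
    have h5 : mfderiv I' 𝓘(ℝ, E') (extChartAt I' (φ p)) (φ p) (mfderiv I I' φ p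
        ((mfderiv I 𝓘(ℝ, E) (extChartAt I p) p).inverse w)) = L w :=
      h4.trans (congrArg L (hA.self_apply_inverse w))
    rw [← h5]
    exact (hA'.inverse_apply_self _).symm
  rw [VectorField.mlieBracket, VectorField.mlieBracket, VectorField.mlieBracketWithin_apply,
    VectorField.mlieBracketWithin_apply]
  refine (hbase _).trans (congrArg _ ?_)
  have kV := key V V' hVV
  have kW := key W W' hWW
  have dV := differentiableAt_mpullbackWithin_extChartAt_symm hV
  have dW := differentiableAt_mpullbackWithin_extChartAt_symm hW
  have dV' := differentiableAt_mpullbackWithin_extChartAt_symm hV'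
  have dW' := differentiableAt_mpullbackWithin_extChartAt_symm hW'
  rw [Set.preimage_univ, Set.preimage_univ, Set.univ_inter, Set.univ_inter]
  have hz : L (extChartAt I p p) = extChartAt I' (φ p) (φ p) := (congrFun hchart p).symm
  generalize VectorField.mpullbackWithin 𝓘(ℝ, E) I
    (extChartAt I p).symm V (Set.range I) = A at *
  generalize VectorField.mpullbackWithin 𝓘(ℝ, E) I
    (extChartAt I p).symm W (Set.range I) = B at *
  generalize VectorField.mpullbackWithin 𝓘(ℝ, E') I'
    (extChartAt I' (φ p)).symm V' (Set.range I') = A' at *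
  generalize VectorField.mpullbackWithin 𝓘(ℝ, E') I'
    (extChartAt I' (φ p)).symm W' (Set.range I') = B' at *
  rw [hr, hr']
  exact map_lieBracketWithin_univ L hz dV dW dV' dW' kV kW

/-- The pullback of a smooth one-form by a smooth map is smooth. -/
lemma smoothNear_pullback {φ : M → M'} (hφ : ContMDiff I I' ∞ φ) {α : OneForm I' M'} {p : M}
    (hα : α.SmoothNear (φ p)) :
    OneForm.SmoothNear (I := I) (fun q ↦ (α (φ q)) ∘L (mfderiv I I' φ q)) p := by
  filter_upwards [hφ.continuous.continuousAt.eventually hα] with q hq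
  have h1 := ((contMDiffAt_hom_bundle _).mp hq).2.comp q (hφ q)
  have h2 := ContMDiffAt.mfderiv_const (m := ∞) (n := ∞) (hφ q) (by simp)
  rw [contMDiffAt_hom_bundle]
  refine ⟨contMDiffAt_id, (h1.clm_comp h2).congr_of_eventuallyEq ?_⟩
  have A : ∀ᶠ m in 𝓝 q, φ m ∈ (trivializationAt E' (TangentSpace I') (φ q)).baseSet :=
    hφ.continuous.continuousAt.eventually
      ((trivializationAt E' (TangentSpace I') (φ q)).open_baseSet.mem_nhds
        (FiberBundle.mem_baseSet_trivializationAt' (φ q)))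
  filter_upwards [A] with m hm
  refine ContinuousLinearMap.ext fun v ↦ ?_
  simp only [inTangentCoordinates, ContinuousLinearMap.inCoordinates,
    Function.comp_apply, ContinuousLinearMap.comp_apply, id_eq]
  rw [Bundle.Trivialization.symmL_continuousLinearMapAt _ hm]
  rfl

end Related

section Product

variable {E₁ : Type*} [NormedAddCommGroup E₁] [NormedSpace ℝ E₁] [FiniteDimensional ℝ E₁]
  {H₁ : Type*} [TopologicalSpace H₁] {I₁ : ModelWithCorners ℝ E₁ H₁}
  {M₁ : Type*} [TopologicalSpace M₁] [ChartedSpace H₁ M₁] [IsManifold I₁ ∞ M₁]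
  {E₂ : Type*} [NormedAddCommGroup E₂] [NormedSpace ℝ E₂] [FiniteDimensional ℝ E₂]
  {H₂ : Type*} [TopologicalSpace H₂] {I₂ : ModelWithCorners ℝ E₂ H₂}
  {M₂ : Type*} [TopologicalSpace M₂] [ChartedSpace H₂ M₂] [IsManifold I₂ ∞ M₂]

lemma dproj₁_eq (p : M₁ × M₂) :
    dproj₁ (I₁ := I₁) (I₂ := I₂) p = ContinuousLinearMap.fst ℝ E₁ E₂ := mfderiv_fst

lemma dproj₂_eq (p : M₁ × M₂) :
    dproj₂ (I₁ := I₁) (I₂ := I₂) p = ContinuousLinearMap.snd ℝ E₁ E₂ := mfderiv_snd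

lemma hliftVec_eq (p : M₁ × M₂) :
    hliftVec (I₁ := I₁) (I₂ := I₂) p = ContinuousLinearMap.inl ℝ E₁ E₂ := mfderiv_prod_left

lemma vliftVec_eq (p : M₁ × M₂) :
    vliftVec (I₁ := I₁) (I₂ := I₂) p = ContinuousLinearMap.inr ℝ E₁ E₂ := mfderiv_prod_right

@[simp] lemma dproj₁_hliftVec (p : M₁ × M₂) (v : TangentSpace I₁ p.1) :
    dproj₁ (I₁ := I₁) (I₂ := I₂) p (hliftVec p v) = v := by
  rw [dproj₁_eq, hliftVec_eq]; rfl

@[simp] lemma dproj₂_hliftVec (p : M₁ × M₂) (v : TangentSpace I₁ p.1) :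
    dproj₂ (I₁ := I₁) (I₂ := I₂) p (hliftVec p v) = 0 := by
  rw [dproj₂_eq, hliftVec_eq]; rfl

@[simp] lemma dproj₁_vliftVec (p : M₁ × M₂) (v : TangentSpace I₂ p.2) :
    dproj₁ (I₁ := I₁) (I₂ := I₂) p (vliftVec p v) = 0 := by
  rw [dproj₁_eq, vliftVec_eq]; rfl

@[simp] lemma dproj₂_vliftVec (p : M₁ × M₂) (v : TangentSpace I₂ p.2) :
    dproj₂ (I₁ := I₁) (I₂ := I₂) p (vliftVec p v) = v := by
  rw [dproj₂_eq, vliftVec_eq]; rfl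

lemma hliftVec_add_vliftVec (p : M₁ × M₂) (v : TangentSpace (I₁.prod I₂) p) :
    hliftVec p (dproj₁ p v) + vliftVec p (dproj₂ p v) = v := by
  rw [dproj₁_eq, hliftVec_eq, dproj₂_eq, vliftVec_eq]
  exact Prod.ext (add_zero _) (zero_add _)

lemma tangent_prod_ext {p : M₁ × M₂} {v w : TangentSpace (I₁.prod I₂) p}
    (h1 : dproj₁ p v = dproj₁ p w) (h2 : dproj₂ p v = dproj₂ p w) : v = w := by
  rw [← hliftVec_add_vliftVec p v, ← hliftVec_add_vliftVec p w, h1, h2]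

/-- The lift of a smooth one-form of the first factor is smooth. -/
lemma smoothNear_hlift {α : OneForm I₁ M₁} {p : M₁ × M₂} (hα : α.SmoothNear p.1) :
    (hlift (I₂ := I₂) α : OneForm (I₁.prod I₂) (M₁ × M₂)).SmoothNear p :=
  smoothNear_pullback (φ := (Prod.fst : M₁ × M₂ → M₁)) contMDiff_fst hα

/-- The lift of a smooth one-form of the second factor is smooth. -/
lemma smoothNear_vlift {α : OneForm I₂ M₂} {p : M₁ × M₂} (hα : α.SmoothNear p.2) :
    (vlift (I₁ := I₁) α : OneForm (I₁.prod I₂) (M₁ × M₂)).SmoothNear p :=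
  smoothNear_pullback (φ := (Prod.snd : M₁ × M₂ → M₂)) contMDiff_snd hα

lemma dproj₁_mlieBracket [I₁.Boundaryless] [I₂.Boundaryless]
    {V W : VField (I₁.prod I₂) (M₁ × M₂)} {V₁ W₁ : VField I₁ M₁} {p : M₁ × M₂}
    (hV : MDiffAt (T% V) p) (hW : MDiffAt (T% W) p)
    (hV₁ : MDiffAt (T% V₁) p.1) (hW₁ : MDiffAt (T% W₁) p.1)
    (hVV : ∀ q, dproj₁ q (V q) = V₁ q.1) (hWW : ∀ q, dproj₁ q (W q) = W₁ q.1) :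
    dproj₁ p (VectorField.mlieBracket (I₁.prod I₂) V W p)
      = VectorField.mlieBracket I₁ V₁ W₁ p.1 := by
  refine mfderiv_mlieBracket_of_related (φ := Prod.fst) (ContinuousLinearMap.fst ℝ E₁ E₂)
    (fun _ ↦ mdifferentiableAt_fst) ?_ ?_ ?_ hV hW hV₁ hW₁
    (Filter.Eventually.of_forall hVV) (Filter.Eventually.of_forall hWW)
  · rw [extChartAt_prod]; rfl
  · rw [extChartAt_prod]; rfl
  · rw [extChartAt_prod]; exact fun z hz ↦ hz.1

lemma dproj₂_mlieBracket [I₁.Boundaryless] [I₂.Boundaryless]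
    {V W : VField (I₁.prod I₂) (M₁ × M₂)} {V₂ W₂ : VField I₂ M₂} {p : M₁ × M₂}
    (hV : MDiffAt (T% V) p) (hW : MDiffAt (T% W) p)
    (hV₂ : MDiffAt (T% V₂) p.2) (hW₂ : MDiffAt (T% W₂) p.2)
    (hVV : ∀ q, dproj₂ q (V q) = V₂ q.2) (hWW : ∀ q, dproj₂ q (W q) = W₂ q.2) :
    dproj₂ p (VectorField.mlieBracket (I₁.prod I₂) V W p)
      = VectorField.mlieBracket I₂ V₂ W₂ p.2 := by
  refine mfderiv_mlieBracket_of_related (φ := Prod.snd) (ContinuousLinearMap.snd ℝ E₁ E₂)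
    (fun _ ↦ mdifferentiableAt_snd) ?_ ?_ ?_ hV hW hV₂ hW₂
    (Filter.Eventually.of_forall hVV) (Filter.Eventually.of_forall hWW)
  · rw [extChartAt_prod]; rfl
  · rw [extChartAt_prod]; rfl
  · rw [extChartAt_prod]; exact fun z hz ↦ hz.2

end Product

section Lifts

variable {E₁ : Type*} [NormedAddCommGroup E₁] [NormedSpace ℝ E₁] [FiniteDimensional ℝ E₁]
  {H₁ : Type*} [TopologicalSpace H₁] {I₁ : ModelWithCorners ℝ E₁ H₁}
  {M₁ : Type*} [TopologicalSpace M₁] [ChartedSpace H₁ M₁] [IsManifold I₁ ∞ M₁]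
  {E₂ : Type*} [NormedAddCommGroup E₂] [NormedSpace ℝ E₂] [FiniteDimensional ℝ E₂]
  {H₂ : Type*} [TopologicalSpace H₂] {I₂ : ModelWithCorners ℝ E₂ H₂}
  {M₂ : Type*} [TopologicalSpace M₂] [ChartedSpace H₂ M₂] [IsManifold I₂ ∞ M₂]

/-- The horizontal lift of a covector. -/
def hcov (p : M₁ × M₂) : Cotangent I₁ p.1 →L[ℝ] Cotangent (I₁.prod I₂) p :=
  ContinuousLinearMap.precomp ℝ (dproj₁ p)

/-- The vertical lift of a covector. -/
def vcov (p : M₁ × M₂) : Cotangent I₂ p.2 →L[ℝ] Cotangent (I₁.prod I₂) p :=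
  ContinuousLinearMap.precomp ℝ (dproj₂ p)

lemma hlift_apply (α : OneForm I₁ M₁) (p : M₁ × M₂) :
    hlift (I₂ := I₂) α p = hcov p (α p.1) := rfl

lemma vlift_apply (α : OneForm I₂ M₂) (p : M₁ × M₂) :
    vlift (I₁ := I₁) α p = vcov p (α p.2) := rfl

lemma scaledVlift_apply (f : M₁ → ℝ) (α : OneForm I₂ M₂) (p : M₁ × M₂) :
    scaledVlift (I₁ := I₁) f α p = f p.1 • vcov p (α p.2) := rfl

lemma hcov_apply (p : M₁ × M₂) (ξ : Cotangent I₁ p.1) (v : TangentSpace (I₁.prod I₂) p) :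
    hcov p ξ v = ξ (dproj₁ p v) := rfl

lemma vcov_apply (p : M₁ × M₂) (ξ : Cotangent I₂ p.2) (v : TangentSpace (I₁.prod I₂) p) :
    vcov p ξ v = ξ (dproj₂ p v) := rfl

lemma exists_eq_hcov_add_vcov (p : M₁ × M₂) (ξ : Cotangent (I₁.prod I₂) p) :
    ∃ (ξ₁ : Cotangent I₁ p.1) (ξ₂ : Cotangent I₂ p.2), ξ = hcov p ξ₁ + vcov p ξ₂ := by
  refine ⟨ξ ∘L hliftVec p, ξ ∘L vliftVec p, ContinuousLinearMap.ext fun v ↦ ?_⟩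
  conv_lhs => rw [← hliftVec_add_vliftVec p v]
  rw [map_add]
  rfl

section Metric

variable {f : M₁ → ℝ} {g₁ : BilinField I₁ M₁} {g₂ : BilinField I₂ M₂}

lemma warpedMetric_apply (p : M₁ × M₂) (v w : TangentSpace (I₁.prod I₂) p) :
    warpedMetric f g₁ g₂ p v w = g₁ p.1 (dproj₁ p v) (dproj₁ p w)
      + f p.1 ^ 2 * g₂ p.2 (dproj₂ p v) (dproj₂ p w) := rfl

lemma warpedMetric_symm (hg₁ : IsPseudoRiemannian g₁) (hg₂ : IsPseudoRiemannian g₂)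
    (p : M₁ × M₂) (v w : TangentSpace (I₁.prod I₂) p) :
    warpedMetric f g₁ g₂ p v w = warpedMetric f g₁ g₂ p w v := by
  rw [warpedMetric_apply, warpedMetric_apply, hg₁.symm, hg₂.symm]

lemma warpedMetric_nondegenerate (hg₁ : IsPseudoRiemannian g₁) (hg₂ : IsPseudoRiemannian g₂)
    {p : M₁ × M₂} (hf : f p.1 ≠ 0) (v : TangentSpace (I₁.prod I₂) p)
    (h : ∀ w, warpedMetric f g₁ g₂ p v w = 0) : v = 0 := by
  refine tangent_prod_ext ?_ ?_
  · rw [map_zero]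
    refine hg₁.nondegenerate _ _ fun w ↦ ?_
    simpa [warpedMetric_apply] using h (hliftVec p w)
  · rw [map_zero]
    refine hg₂.nondegenerate _ _ fun w ↦ ?_
    simpa [warpedMetric_apply, hf] using h (vliftVec p w)

lemma musicalSharp_warpedMetric (hg₁ : IsPseudoRiemannian g₁) (hg₂ : IsPseudoRiemannian g₂)
    {p : M₁ × M₂} (hf : f p.1 ≠ 0) (ξ₁ : Cotangent I₁ p.1) (ξ₂ : Cotangent I₂ p.2) :
    musicalSharp (warpedMetric f g₁ g₂) p (hcov p ξ₁ + vcov p ξ₂)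
      = hliftVec p (musicalSharp g₁ p.1 ξ₁)
        + (f p.1 ^ 2)⁻¹ • vliftVec p (musicalSharp g₂ p.2 ξ₂) := by
  have hinv := isInvertible_of_nondegenerate (F := E₁ × E₂) (warpedMetric f g₁ g₂ p)
    (warpedMetric_nondegenerate hg₁ hg₂ hf)
  have h : warpedMetric f g₁ g₂ p (hliftVec p (musicalSharp g₁ p.1 ξ₁)
        + (f p.1 ^ 2)⁻¹ • vliftVec p (musicalSharp g₂ p.2 ξ₂)) = hcov p ξ₁ + vcov p ξ₂ := by
    refine ContinuousLinearMap.ext fun w ↦ ?_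
    rw [warpedMetric_apply]
    simp only [map_add, map_smul, dproj₁_hliftVec, dproj₁_vliftVec, dproj₂_hliftVec,
      dproj₂_vliftVec, smul_zero, add_zero, zero_add, musicalSharp_apply hg₁,
      musicalSharp_apply hg₂, smul_apply, add_apply,
      hcov_apply, vcov_apply, smul_eq_mul]
    field_simp
  rw [← h]
  exact hinv.inverse_apply_self _

lemma cometric_warpedMetric (hg₁ : IsPseudoRiemannian g₁) (hg₂ : IsPseudoRiemannian g₂)
    {p : M₁ × M₂} (hf : f p.1 ≠ 0) (ξ₁ η₁ : Cotangent I₁ p.1) (ξ₂ η₂ : Cotangent I₂ p.2) :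
    cometric (warpedMetric f g₁ g₂) p (hcov p ξ₁ + vcov p ξ₂) (hcov p η₁ + vcov p η₂)
      = cometric g₁ p.1 ξ₁ η₁ + cometric g₂ p.2 ξ₂ η₂ / f p.1 ^ 2 := by
  rw [cometric, musicalSharp_warpedMetric hg₁ hg₂ hf, musicalSharp_warpedMetric hg₁ hg₂ hf,
    warpedMetric_apply]
  simp only [map_add, map_smul, dproj₁_hliftVec, dproj₁_vliftVec, dproj₂_hliftVec,
      dproj₂_vliftVec, smul_zero, add_zero, zero_add, smul_apply, smul_eq_mul,
      cometric]
  field_simp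

lemma cometric_hcov_hcov (hg₁ : IsPseudoRiemannian g₁) (hg₂ : IsPseudoRiemannian g₂)
    {p : M₁ × M₂} (hf : f p.1 ≠ 0) (ξ η : Cotangent I₁ p.1) :
    cometric (warpedMetric f g₁ g₂) p (hcov p ξ) (hcov p η) = cometric g₁ p.1 ξ η := by
  simpa using cometric_warpedMetric hg₁ hg₂ hf ξ η 0 0

lemma cometric_hcov_vcov (hg₁ : IsPseudoRiemannian g₁) (hg₂ : IsPseudoRiemannian g₂)
    {p : M₁ × M₂} (hf : f p.1 ≠ 0) (ξ : Cotangent I₁ p.1) (η : Cotangent I₂ p.2) :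
    cometric (warpedMetric f g₁ g₂) p (hcov p ξ) (vcov p η) = 0 := by
  simpa using cometric_warpedMetric hg₁ hg₂ hf ξ 0 0 η

lemma cometric_vcov_hcov (hg₁ : IsPseudoRiemannian g₁) (hg₂ : IsPseudoRiemannian g₂)
    {p : M₁ × M₂} (hf : f p.1 ≠ 0) (ξ : Cotangent I₂ p.2) (η : Cotangent I₁ p.1) :
    cometric (warpedMetric f g₁ g₂) p (vcov p ξ) (hcov p η) = 0 := by
  simpa using cometric_warpedMetric hg₁ hg₂ hf 0 η ξ 0

lemma cometric_vcov_vcov (hg₁ : IsPseudoRiemannian g₁) (hg₂ : IsPseudoRiemannian g₂)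
    {p : M₁ × M₂} (hf : f p.1 ≠ 0) (ξ η : Cotangent I₂ p.2) :
    cometric (warpedMetric f g₁ g₂) p (vcov p ξ) (vcov p η)
      = cometric g₂ p.2 ξ η / f p.1 ^ 2 := by
  simpa using cometric_warpedMetric hg₁ hg₂ hf 0 0 ξ η

lemma cotangent_prod_ext (hg₁ : IsPseudoRiemannian g₁) (hg₂ : IsPseudoRiemannian g₂)
    {p : M₁ × M₂} (hf : f p.1 ≠ 0) {ξ η : Cotangent (I₁.prod I₂) p}
    (h₁ : ∀ γ : Cotangent I₁ p.1, cometric (warpedMetric f g₁ g₂) p ξ (hcov p γ)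
      = cometric (warpedMetric f g₁ g₂) p η (hcov p γ))
    (h₂ : ∀ γ : Cotangent I₂ p.2, cometric (warpedMetric f g₁ g₂) p ξ (vcov p γ)
      = cometric (warpedMetric f g₁ g₂) p η (vcov p γ)) : ξ = η := by
  obtain ⟨ζ₁, ζ₂, hζ⟩ := exists_eq_hcov_add_vcov p (ξ - η)
  have e₁ : ζ₁ = 0 := cometric_nondegenerate hg₁ fun γ ↦ by
    rw [← cometric_hcov_hcov hg₁ hg₂ hf]
    have := sub_eq_zero.mpr (h₁ γ)
    rwa [← cometric_sub_left, hζ, cometric_add_left, cometric_vcov_hcov hg₁ hg₂ hf,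
      add_zero] at this
  have e₂ : ζ₂ = 0 := cometric_nondegenerate hg₂ fun γ ↦ by
    have := sub_eq_zero.mpr (h₂ γ)
    rw [← cometric_sub_left, hζ, cometric_add_left, cometric_hcov_vcov hg₁ hg₂ hf,
      zero_add, cometric_vcov_vcov hg₁ hg₂ hf] at this
    simpa [hf] using this
  rw [← sub_eq_zero, hζ, e₁, e₂, map_zero, map_zero, add_zero]

end Metric

section AnchorLifts

variable {ν : M₁ → ℝ} {P₁ : Anchor I₁ M₁} {P₂ : Anchor I₂ M₂}

lemma warpedBivector_hcov (p : M₁ × M₂) (ξ : Cotangent I₁ p.1) :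
    warpedBivector ν P₁ P₂ p (hcov p ξ) = hliftVec p (P₁ p.1 ξ) := by
  have h1 : (ContinuousLinearMap.precomp ℝ (hliftVec (I₁ := I₁) (I₂ := I₂) p)) (hcov p ξ) = ξ :=
    ContinuousLinearMap.ext fun v ↦ congrArg ξ (dproj₁_hliftVec p v)
  have h2 : (ContinuousLinearMap.precomp ℝ (vliftVec (I₁ := I₁) (I₂ := I₂) p)) (hcov p ξ) = 0 :=
    ContinuousLinearMap.ext fun v ↦ (congrArg ξ (dproj₁_vliftVec p v)).trans (map_zero ξ)
  simp [warpedBivector, h1, h2]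

lemma warpedBivector_vcov (p : M₁ × M₂) (ξ : Cotangent I₂ p.2) :
    warpedBivector ν P₁ P₂ p (vcov p ξ) = ν p.1 • vliftVec p (P₂ p.2 ξ) := by
  have h1 : (ContinuousLinearMap.precomp ℝ (hliftVec (I₁ := I₁) (I₂ := I₂) p)) (vcov p ξ) = 0 :=
    ContinuousLinearMap.ext fun v ↦ (congrArg ξ (dproj₂_hliftVec p v)).trans (map_zero ξ)
  have h2 : (ContinuousLinearMap.precomp ℝ (vliftVec (I₁ := I₁) (I₂ := I₂) p)) (vcov p ξ) = ξ :=
    ContinuousLinearMap.ext fun v ↦ congrArg ξ (dproj₂_vliftVec p v)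
  simp [warpedBivector, h1, h2]

end AnchorLifts

section Functions

lemma mvfderiv_comp_fst {u : M₁ → ℝ} {p : M₁ × M₂} (hu : MDiffAt u p.1) :
    mvfderiv (I₁.prod I₂) (fun q : M₁ × M₂ ↦ u q.1) p = hcov p (mvfderiv I₁ u p.1) :=
  mvfderiv_comp (f := (Prod.fst : M₁ × M₂ → M₁)) p hu mdifferentiableAt_fst

lemma mvfderiv_comp_snd {u : M₂ → ℝ} {p : M₁ × M₂} (hu : MDiffAt u p.2) :
    mvfderiv (I₁.prod I₂) (fun q : M₁ × M₂ ↦ u q.2) p = vcov p (mvfderiv I₂ u p.2) :=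
  mvfderiv_comp (f := (Prod.snd : M₁ × M₂ → M₂)) p hu mdifferentiableAt_snd

end Functions

section Fields

/-- The horizontal lift of a vector field. -/
def hfield (X : VField I₁ M₁) : VField (I₁.prod I₂) (M₁ × M₂) := fun p ↦ hliftVec p (X p.1)

/-- The vertical lift of a vector field. -/
def vfield (X : VField I₂ M₂) : VField (I₁.prod I₂) (M₁ × M₂) := fun p ↦ vliftVec p (X p.2)

lemma mdifferentiableAt_hfield {X : VField I₁ M₁} {p : M₁ × M₂} (hX : MDiffAt (T% X) p.1) :
    MDiffAt (T% (hfield (I₂ := I₂) X : VField (I₁.prod I₂) (M₁ × M₂))) p := by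
  have h1 : MDiffAt (fun q : M₁ × M₂ ↦ (T% X) q.1) p := hX.comp p mdifferentiableAt_fst
  have h2 : MDiffAt
      (fun q : M₁ × M₂ ↦ Bundle.zeroSection E₂ (TangentSpace I₂ : M₂ → Type _) q.2) p :=
    (Bundle.mdifferentiable_zeroSection (𝕜 := ℝ) (IB := I₂) (F := E₂)
      (E := (TangentSpace I₂ : M₂ → Type _)) p.2).comp p mdifferentiableAt_snd
  have h3 := (contMDiff_equivTangentBundleProd_symm (n := 1) (I := I₁) (M := M₁) (I' := I₂)
    (M' := M₂) _).mdifferentiableAt one_ne_zero |>.comp p (h1.prodMk h2)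
  refine h3.congr_of_eventuallyEq (Filter.Eventually.of_forall fun q ↦ ?_)
  simp only [hfield, hliftVec_eq]
  rfl

lemma mdifferentiableAt_vfield {X : VField I₂ M₂} {p : M₁ × M₂} (hX : MDiffAt (T% X) p.2) :
    MDiffAt (T% (vfield (I₁ := I₁) X : VField (I₁.prod I₂) (M₁ × M₂))) p := by
  have h1 : MDiffAt (fun q : M₁ × M₂ ↦ (T% X) q.2) p := hX.comp p mdifferentiableAt_snd
  have h2 : MDiffAt
      (fun q : M₁ × M₂ ↦ Bundle.zeroSection E₁ (TangentSpace I₁ : M₁ → Type _) q.1) p :=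
    (Bundle.mdifferentiable_zeroSection (𝕜 := ℝ) (IB := I₁) (F := E₁)
      (E := (TangentSpace I₁ : M₁ → Type _)) p.1).comp p mdifferentiableAt_fst
  have h3 := (contMDiff_equivTangentBundleProd_symm (n := 1) (I := I₁) (M := M₁) (I' := I₂)
    (M' := M₂) _).mdifferentiableAt one_ne_zero |>.comp p (h2.prodMk h1)
  refine h3.congr_of_eventuallyEq (Filter.Eventually.of_forall fun q ↦ ?_)
  simp only [vfield, vliftVec_eq]
  rfl

lemma mdifferentiableAt_zero_field (x : M₁) : MDiffAt (T% (0 : VField I₁ M₁)) x :=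
  Bundle.mdifferentiable_zeroSection (𝕜 := ℝ) (IB := I₁) (F := E₁)
    (E := (TangentSpace I₁ : M₁ → Type _)) x

variable [I₁.Boundaryless] [I₂.Boundaryless] {p : M₁ × M₂}

lemma mlieBracket_hfield_hfield {X Y : VField I₁ M₁} (hX : MDiffAt (T% X) p.1)
    (hY : MDiffAt (T% Y) p.1) :
    VectorField.mlieBracket (I₁.prod I₂) (hfield X) (hfield Y) p
      = hliftVec p (VectorField.mlieBracket I₁ X Y p.1) := by
  refine tangent_prod_ext ?_ ?_
  · rw [dproj₁_hliftVec, dproj₁_mlieBracket (mdifferentiableAt_hfield hX)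
      (mdifferentiableAt_hfield hY) hX hY (fun q ↦ dproj₁_hliftVec q _)
      (fun q ↦ dproj₁_hliftVec q _)]
  · rw [dproj₂_hliftVec, dproj₂_mlieBracket (mdifferentiableAt_hfield hX)
      (mdifferentiableAt_hfield hY) (mdifferentiableAt_zero_field _)
      (mdifferentiableAt_zero_field _) (fun q ↦ dproj₂_hliftVec q _)
      (fun q ↦ dproj₂_hliftVec q _), VectorField.mlieBracket_zero_left]
    rfl

lemma mlieBracket_hfield_vfield {X : VField I₁ M₁} {Y : VField I₂ M₂} (hX : MDiffAt (T% X) p.1)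
    (hY : MDiffAt (T% Y) p.2) :
    VectorField.mlieBracket (I₁.prod I₂) (hfield X) (vfield Y) p = 0 := by
  refine tangent_prod_ext ?_ ?_
  · rw [map_zero, dproj₁_mlieBracket (mdifferentiableAt_hfield hX)
      (mdifferentiableAt_vfield hY) hX (mdifferentiableAt_zero_field _)
      (fun q ↦ dproj₁_hliftVec q _) (fun q ↦ dproj₁_vliftVec q _),
      VectorField.mlieBracket_zero_right]
    rfl
  · rw [map_zero, dproj₂_mlieBracket (mdifferentiableAt_hfield hX)
      (mdifferentiableAt_vfield hY) (mdifferentiableAt_zero_field _) hY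
      (fun q ↦ dproj₂_hliftVec q _) (fun q ↦ dproj₂_vliftVec q _),
      VectorField.mlieBracket_zero_left]
    rfl

lemma mlieBracket_vfield_vfield {X Y : VField I₂ M₂} (hX : MDiffAt (T% X) p.2)
    (hY : MDiffAt (T% Y) p.2) :
    VectorField.mlieBracket (I₁.prod I₂) (vfield X) (vfield Y) p
      = vliftVec p (VectorField.mlieBracket I₂ X Y p.2) := by
  refine tangent_prod_ext ?_ ?_
  · rw [dproj₁_vliftVec, dproj₁_mlieBracket (mdifferentiableAt_vfield hX)
      (mdifferentiableAt_vfield hY) (mdifferentiableAt_zero_field _)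
      (mdifferentiableAt_zero_field _) (fun q ↦ dproj₁_vliftVec q _)
      (fun q ↦ dproj₁_vliftVec q _), VectorField.mlieBracket_zero_left]
    rfl
  · rw [dproj₂_vliftVec, dproj₂_mlieBracket (mdifferentiableAt_vfield hX)
      (mdifferentiableAt_vfield hY) hX hY (fun q ↦ dproj₂_vliftVec q _)
      (fun q ↦ dproj₂_vliftVec q _)]

lemma mdifferentiableAt_comp_fst {u : M₁ → ℝ} (hu : MDiffAt u p.1) :
    MDiffAt (fun q : M₁ × M₂ ↦ u q.1) p :=
  hu.comp p mdifferentiableAt_fst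

lemma mdifferentiableAt_comp_snd {u : M₂ → ℝ} (hu : MDiffAt u p.2) :
    MDiffAt (fun q : M₁ × M₂ ↦ u q.2) p :=
  hu.comp p mdifferentiableAt_snd

/-- The bracket of a vertical field with horizontal coefficient and a horizontal field. -/
lemma mlieBracket_smul_vfield_hfield {ν : M₁ → ℝ} (hν : MDiffAt ν p.1) {X : VField I₂ M₂}
    {Y : VField I₁ M₁} (hX : MDiffAt (T% X) p.2) (hY : MDiffAt (T% Y) p.1) :
    VectorField.mlieBracket (I₁.prod I₂) (fun q ↦ ν q.1 • vfield X q) (hfield Y) p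
      = - (mvfderiv I₁ ν p.1 (Y p.1)) • vliftVec p (X p.2) := by
  have h := VectorField.mlieBracket_smul_left (I := I₁.prod I₂) (f := fun q : M₁ × M₂ ↦ ν q.1)
    (V := vfield X) (W := hfield Y) (x := p) (mdifferentiableAt_comp_fst hν)
    (mdifferentiableAt_vfield hX)
  refine h.trans ?_
  rw [mvfderiv_comp_fst hν, VectorField.mlieBracket_swap_apply,
    mlieBracket_hfield_vfield hY hX, hcov_apply, hfield, dproj₁_hliftVec, neg_zero, smul_zero,
    add_zero]
  rfl

/-- The bracket of a vertical field with horizontal coefficient and a vertical field. -/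
lemma mlieBracket_smul_vfield_vfield {ν : M₁ → ℝ} (hν : MDiffAt ν p.1) {X : VField I₂ M₂}
    {Y : VField I₂ M₂} (hX : MDiffAt (T% X) p.2) (hY : MDiffAt (T% Y) p.2) :
    VectorField.mlieBracket (I₁.prod I₂) (fun q ↦ ν q.1 • vfield X q) (vfield Y) p
      = ν p.1 • vliftVec p (VectorField.mlieBracket I₂ X Y p.2) := by
  have h := VectorField.mlieBracket_smul_left (I := I₁.prod I₂) (f := fun q : M₁ × M₂ ↦ ν q.1)
    (V := vfield X) (W := vfield Y) (x := p) (mdifferentiableAt_comp_fst hν)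
    (mdifferentiableAt_vfield hX)
  refine h.trans ?_
  rw [mvfderiv_comp_fst hν, mlieBracket_vfield_vfield hX hY, hcov_apply, vfield,
    dproj₁_vliftVec, map_zero, neg_zero, zero_smul, zero_add]

end Fields

section LieDerivatives

variable [I₁.Boundaryless] [I₂.Boundaryless] {p : M₁ × M₂}

lemma hlift_hfield (α : OneForm I₁ M₁) (X : VField I₁ M₁) (q : M₁ × M₂) :
    hlift (I₂ := I₂) α q (hfield X q) = α q.1 (X q.1) :=
  congrArg (α q.1) (dproj₁_hliftVec q _)

lemma hlift_vfield (α : OneForm I₁ M₁) (X : VField I₂ M₂) (q : M₁ × M₂) :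
    hlift (I₂ := I₂) α q (vfield X q) = 0 :=
  (congrArg (α q.1) (dproj₁_vliftVec q _)).trans (map_zero _)

lemma vlift_hfield (α : OneForm I₂ M₂) (X : VField I₁ M₁) (q : M₁ × M₂) :
    vlift (I₁ := I₁) α q (hfield X q) = 0 :=
  (congrArg (α q.2) (dproj₂_hliftVec q _)).trans (map_zero _)

lemma vlift_vfield (α : OneForm I₂ M₂) (X : VField I₂ M₂) (q : M₁ × M₂) :
    vlift (I₁ := I₁) α q (vfield X q) = α q.2 (X q.2) :=
  congrArg (α q.2) (dproj₂_vliftVec q _)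

section Horizontal

variable {X : VField I₁ M₁} (hX : MDiffAt (T% X) p.1)
include hX

lemma lieDerivEval_hfield_hlift_hfield {β : OneForm I₁ M₁} (hβ : β.SmoothNear p.1)
    {Y : VField I₁ M₁} (hY : MDiffAt (T% Y) p.1) :
    lieDerivEval (hfield X) (hlift (I₂ := I₂) β) p (hfield Y) = lieDerivEval X β p.1 Y := by
  simp only [lieDerivEval, hlift_hfield]
  rw [mvfderiv_comp_fst (mdifferentiableAt_form_apply hβ.mdifferentiableAt hY),
    mlieBracket_hfield_hfield hX hY, hlift_apply, hcov_apply, hcov_apply, hfield,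
    dproj₁_hliftVec, dproj₁_hliftVec]

lemma lieDerivEval_hfield_hlift_vfield {β : OneForm I₁ M₁}
    {Y : VField I₂ M₂} (hY : MDiffAt (T% Y) p.2) :
    lieDerivEval (hfield X) (hlift (I₂ := I₂) β) p (vfield Y) = 0 := by
  simp only [lieDerivEval, hlift_vfield, mlieBracket_hfield_vfield hX hY, mvfderiv_const,
    map_zero, sub_zero]
  rfl

lemma lieDerivEval_hfield_vlift_hfield {β : OneForm I₂ M₂}
    {Y : VField I₁ M₁} (hY : MDiffAt (T% Y) p.1) :
    lieDerivEval (hfield X) (vlift (I₁ := I₁) β) p (hfield Y) = 0 := by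
  simp only [lieDerivEval, vlift_hfield, mvfderiv_const]
  simp only [mlieBracket_hfield_hfield hX hY, vlift_apply, vcov_apply, dproj₂_hliftVec, map_zero,
    sub_zero]
  rfl

lemma lieDerivEval_hfield_vlift_vfield {β : OneForm I₂ M₂} (hβ : β.SmoothNear p.2)
    {Y : VField I₂ M₂} (hY : MDiffAt (T% Y) p.2) :
    lieDerivEval (hfield X) (vlift (I₁ := I₁) β) p (vfield Y) = 0 := by
  simp only [lieDerivEval, vlift_vfield]
  rw [mvfderiv_comp_snd (mdifferentiableAt_form_apply hβ.mdifferentiableAt hY),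
    mlieBracket_hfield_vfield hX hY, map_zero, sub_zero, vcov_apply, hfield, dproj₂_hliftVec,
    map_zero]

end Horizontal

section Vertical

variable {X : VField I₂ M₂} (hX : MDiffAt (T% X) p.2) {ν : M₁ → ℝ} (hν : MDiffAt ν p.1)
include hX hν

lemma lieDerivEval_vfield_hlift_hfield {β : OneForm I₁ M₁} (hβ : β.SmoothNear p.1)
    {Y : VField I₁ M₁} (hY : MDiffAt (T% Y) p.1) :
    lieDerivEval (fun q ↦ ν q.1 • vfield X q) (hlift (I₂ := I₂) β) p (hfield Y) = 0 := by
  simp only [lieDerivEval, hlift_hfield]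
  rw [mvfderiv_comp_fst (mdifferentiableAt_form_apply hβ.mdifferentiableAt hY),
    mlieBracket_smul_vfield_hfield hν hX hY, hlift_apply, hcov_apply, hcov_apply, vfield,
    map_smul, map_smul, dproj₁_vliftVec, map_zero, smul_zero, map_smul, dproj₁_vliftVec, smul_zero,
    map_zero, sub_zero]

lemma lieDerivEval_vfield_hlift_vfield {β : OneForm I₁ M₁}
    {Y : VField I₂ M₂} (hY : MDiffAt (T% Y) p.2) :
    lieDerivEval (fun q ↦ ν q.1 • vfield X q) (hlift (I₂ := I₂) β) p (vfield Y) = 0 := by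
  simp only [lieDerivEval, hlift_vfield, mvfderiv_const]
  simp only [mlieBracket_smul_vfield_vfield hν hX hY,
    hlift_apply, hcov_apply, map_smul, dproj₁_vliftVec, smul_zero, map_zero, sub_zero]
  exact smul_zero _

lemma lieDerivEval_vfield_vlift_hfield {β : OneForm I₂ M₂}
    {Y : VField I₁ M₁} (hY : MDiffAt (T% Y) p.1) :
    lieDerivEval (fun q ↦ ν q.1 • vfield X q) (vlift (I₁ := I₁) β) p (hfield Y)
      = mvfderiv I₁ ν p.1 (Y p.1) * β p.2 (X p.2) := by
  simp only [lieDerivEval, vlift_hfield, mvfderiv_const]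
  refine (zero_sub _).trans ?_
  simp only [mlieBracket_smul_vfield_hfield hν hX hY, vlift_apply, vcov_apply, map_smul,
    dproj₂_vliftVec, smul_eq_mul, neg_mul, neg_neg]

lemma lieDerivEval_vfield_vlift_vfield {β : OneForm I₂ M₂} (hβ : β.SmoothNear p.2)
    {Y : VField I₂ M₂} (hY : MDiffAt (T% Y) p.2) :
    lieDerivEval (fun q ↦ ν q.1 • vfield X q) (vlift (I₁ := I₁) β) p (vfield Y)
      = ν p.1 * lieDerivEval X β p.2 Y := by
  simp only [lieDerivEval, vlift_vfield]
  rw [mvfderiv_comp_snd (mdifferentiableAt_form_apply hβ.mdifferentiableAt hY),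
    mlieBracket_smul_vfield_vfield hν hX hY, vlift_apply, vcov_apply, vcov_apply, vfield,
    map_smul, map_smul, map_smul, map_smul, dproj₂_vliftVec, dproj₂_vliftVec, smul_eq_mul,
    smul_eq_mul, mul_sub]

end Vertical

end LieDerivatives

end Lifts

section ScalarChain

variable {E : Type*} [NormedAddCommGroup E] [NormedSpace ℝ E] [FiniteDimensional ℝ E]
  {H : Type*} [TopologicalSpace H] {I : ModelWithCorners ℝ E H}
  {M : Type*} [TopologicalSpace M] [ChartedSpace H M] [IsManifold I ∞ M]

lemma mvfderiv_comp_hasDerivAt {φ : ℝ → ℝ} {φ' : ℝ} {u : M → ℝ} {x : M}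
    (hφ : HasDerivAt φ φ' (u x)) (hu : MDiffAt u x) (v : TangentSpace I x) :
    mvfderiv I (fun y ↦ φ (u y)) x v = φ' * mvfderiv I u x v := by
  have h : HasMFDerivAt I 𝓘(ℝ, ℝ) (φ ∘ u) x _ :=
    HasMFDerivAt.comp x hφ.hasFDerivAt.hasMFDerivAt hu.hasMFDerivAt
  have h2 : mvfderiv I (fun y ↦ φ (u y)) x v = mvfderiv I u x v * φ' :=
    congrArg (fun A ↦ A v) h.mfderiv
  rw [h2, mul_comm]

lemma MDifferentiableAt.comp_hasDerivAt {φ : ℝ → ℝ} {φ' : ℝ} {u : M → ℝ} {x : M}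
    (hφ : HasDerivAt φ φ' (u x)) (hu : MDiffAt u x) : MDiffAt (fun y ↦ φ (u y)) x :=
  (HasMFDerivAt.comp x hφ.hasFDerivAt.hasMFDerivAt hu.hasMFDerivAt).mdifferentiableAt

/-- Derivative of `f⁻²`. -/
lemma hasDerivAt_sq_inv {t : ℝ} (ht : t ≠ 0) :
    HasDerivAt (fun s : ℝ ↦ (s ^ 2)⁻¹) (-2 / t ^ 3) t := by
  have h := ((hasDerivAt_id t).pow 2).inv (pow_ne_zero 2 ht)
  refine h.congr_deriv ?_
  simp
  field_simp

/-- `(♯α)(u) = - g̃(J du, α)`. -/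
lemma mvfderiv_anchor_apply {g : BilinField I M} (hg : IsPseudoRiemannian g) {P : Anchor I M}
    (hP : IsPoisson P) (u : M → ℝ) (x : M) (ξ : Cotangent I x) :
    mvfderiv I u x (P x ξ) = - cometric g x (Jd g P u x) ξ := by
  rw [Jd, cometric_fieldEndo hg, hP.skew, neg_neg]
  rfl

end ScalarChain

section Brackets

variable {E₁ : Type*} [NormedAddCommGroup E₁] [NormedSpace ℝ E₁] [FiniteDimensional ℝ E₁]
  {H₁ : Type*} [TopologicalSpace H₁] {I₁ : ModelWithCorners ℝ E₁ H₁}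
  {M₁ : Type*} [TopologicalSpace M₁] [ChartedSpace H₁ M₁] [IsManifold I₁ ∞ M₁]
  {E₂ : Type*} [NormedAddCommGroup E₂] [NormedSpace ℝ E₂] [FiniteDimensional ℝ E₂]
  {H₂ : Type*} [TopologicalSpace H₂] {I₂ : ModelWithCorners ℝ E₂ H₂}
  {M₂ : Type*} [TopologicalSpace M₂] [ChartedSpace H₂ M₂] [IsManifold I₂ ∞ M₂]
  [I₁.Boundaryless] [I₂.Boundaryless]

lemma mvfderiv_fst_mul_snd {u : M₁ → ℝ} {w : M₂ → ℝ} {p : M₁ × M₂} (hu : MDiffAt u p.1)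
    (hw : MDiffAt w p.2) :
    mvfderiv (I₁.prod I₂) (fun q : M₁ × M₂ ↦ u q.1 * w q.2) p
      = u p.1 • vcov p (mvfderiv I₂ w p.2) + w p.2 • hcov p (mvfderiv I₁ u p.1) := by
  rw [← mvfderiv_comp_fst hu, ← mvfderiv_comp_snd hw]
  exact mvfderiv_mul (mdifferentiableAt_comp_fst hu) (mdifferentiableAt_comp_snd hw)

lemma cotangent_ext_fields {p : M₁ × M₂} {ξ η : Cotangent (I₁.prod I₂) p}
    (h₁ : ∀ Y : VField I₁ M₁, MDiffAt (T% Y) p.1 → ξ (hfield Y p) = η (hfield Y p))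
    (h₂ : ∀ Y : VField I₂ M₂, MDiffAt (T% Y) p.2 → ξ (vfield Y p) = η (vfield Y p)) : ξ = η := by
  refine ContinuousLinearMap.ext fun v ↦ ?_
  obtain ⟨Y₁, hY₁, e₁⟩ := exists_vectorField p.1 (dproj₁ p v)
  obtain ⟨Y₂, hY₂, e₂⟩ := exists_vectorField p.2 (dproj₂ p v)
  have h3 := h₁ Y₁ hY₁
  have h4 := h₂ Y₂ hY₂
  rw [hfield, e₁] at h3
  rw [vfield, e₂] at h4
  rw [← hliftVec_add_vliftVec p v, map_add, map_add, h3, h4]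

variable {ν : M₁ → ℝ} {P₁ : Anchor I₁ M₁} {P₂ : Anchor I₂ M₂}

lemma warpedBivector_hlift (α : OneForm I₁ M₁) :
    (fun q ↦ warpedBivector ν P₁ P₂ q (hlift (I₂ := I₂) α q) : VField (I₁.prod I₂) (M₁ × M₂))
      = hfield fun x ↦ P₁ x (α x) :=
  funext fun q ↦ warpedBivector_hcov q (α q.1)

lemma warpedBivector_vlift (α : OneForm I₂ M₂) :
    (fun q ↦ warpedBivector ν P₁ P₂ q (vlift (I₁ := I₁) α q) : VField (I₁.prod I₂) (M₁ × M₂))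
      = fun q ↦ ν q.1 • vfield (fun x ↦ P₂ x (α x)) q :=
  funext fun q ↦ warpedBivector_vcov q (α q.2)

variable {p : M₁ × M₂}

lemma formBracket_hlift_hlift (hP₁ : IsPoisson P₁) {α β : OneForm I₁ M₁}
    (hα : α.SmoothNear p.1) (hβ : β.SmoothNear p.1) :
    formBracket (warpedBivector ν P₁ P₂) (hlift (I₂ := I₂) α) (hlift β) p
      = hcov p (formBracket P₁ α β p.1) := by
  have dα := mdifferentiableAt_anchor_apply hP₁ hα
  have dβ := mdifferentiableAt_anchor_apply hP₁ hβ
  have hpair : (fun q ↦ (warpedBivector ν P₁ P₂).pair q (hlift (I₂ := I₂) α q) (hlift β q))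
      = fun q ↦ P₁.pair q.1 (α q.1) (β q.1) := by
    funext q
    rw [Anchor.pair, hlift_apply, hlift_apply, warpedBivector_hcov, hcov_apply, dproj₁_hliftVec]
    rfl
  have dpair : MDiffAt (fun x ↦ P₁.pair x (α x) (β x)) p.1 :=
    mdifferentiableAt_form_apply hβ.mdifferentiableAt dα
  refine cotangent_ext_fields (fun Y hY ↦ ?_) (fun Y hY ↦ ?_)
  · rw [formBracket_apply _ (smoothNear_hlift hα) (smoothNear_hlift hβ)
      (mdifferentiableAt_hfield hY), warpedBivector_hlift, warpedBivector_hlift, hpair,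
      lieDerivEval_hfield_hlift_hfield dα hβ hY, lieDerivEval_hfield_hlift_hfield dβ hα hY,
      mvfderiv_comp_fst dpair, hcov_apply, hcov_apply, hfield, dproj₁_hliftVec,
      formBracket_apply _ hα hβ hY]
  · rw [formBracket_apply _ (smoothNear_hlift hα) (smoothNear_hlift hβ)
      (mdifferentiableAt_vfield hY), warpedBivector_hlift, warpedBivector_hlift, hpair,
      lieDerivEval_hfield_hlift_vfield dα hY, lieDerivEval_hfield_hlift_vfield dβ hY,
      mvfderiv_comp_fst dpair, hcov_apply, hcov_apply, vfield, dproj₁_vliftVec, map_zero,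
      map_zero, sub_zero, sub_zero]

lemma formBracket_hlift_vlift (hP₁ : IsPoisson P₁) (hP₂ : IsPoisson P₂) (hν : MDiffAt ν p.1)
    {α : OneForm I₁ M₁} {β : OneForm I₂ M₂} (hα : α.SmoothNear p.1) (hβ : β.SmoothNear p.2) :
    formBracket (warpedBivector ν P₁ P₂) (hlift (I₂ := I₂) α) (vlift (I₁ := I₁) β) p = 0 := by
  have dα := mdifferentiableAt_anchor_apply hP₁ hα
  have dβ := mdifferentiableAt_anchor_apply hP₂ hβ
  have hpair : (fun q ↦ (warpedBivector ν P₁ P₂).pair q (hlift (I₂ := I₂) α q)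
      (vlift (I₁ := I₁) β q)) = fun _ ↦ 0 := by
    funext q
    rw [Anchor.pair, hlift_apply, warpedBivector_hcov, vlift_apply, vcov_apply, dproj₂_hliftVec,
      map_zero]
  refine cotangent_ext_fields (fun Y hY ↦ ?_) (fun Y hY ↦ ?_)
  · rw [formBracket_apply _ (smoothNear_hlift hα) (smoothNear_vlift hβ)
      (mdifferentiableAt_hfield hY), warpedBivector_hlift, warpedBivector_vlift, hpair,
      lieDerivEval_hfield_vlift_hfield dα hY, lieDerivEval_vfield_hlift_hfield dβ hν hα hY,
      mvfderiv_const, sub_zero]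
    exact sub_zero _
  · rw [formBracket_apply _ (smoothNear_hlift hα) (smoothNear_vlift hβ)
      (mdifferentiableAt_vfield hY), warpedBivector_hlift, warpedBivector_vlift, hpair,
      lieDerivEval_hfield_vlift_vfield dα hβ hY, lieDerivEval_vfield_hlift_vfield dβ hν hY,
      mvfderiv_const, sub_zero]
    exact sub_zero _

lemma formBracket_vlift_vlift (hP₂ : IsPoisson P₂) (hν : MDiffAt ν p.1)
    {α β : OneForm I₂ M₂} (hα : α.SmoothNear p.2) (hβ : β.SmoothNear p.2) :
    formBracket (warpedBivector ν P₁ P₂) (vlift (I₁ := I₁) α) (vlift β) p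
      = ν p.1 • vcov p (formBracket P₂ α β p.2)
        + P₂.pair p.2 (α p.2) (β p.2) • hcov p (mvfderiv I₁ ν p.1) := by
  have dα := mdifferentiableAt_anchor_apply hP₂ hα
  have dβ := mdifferentiableAt_anchor_apply hP₂ hβ
  have hpair : (fun q ↦ (warpedBivector ν P₁ P₂).pair q (vlift (I₁ := I₁) α q) (vlift β q))
      = fun q ↦ ν q.1 * P₂.pair q.2 (α q.2) (β q.2) := by
    funext q
    rw [Anchor.pair, vlift_apply, vlift_apply, warpedBivector_vcov, vcov_apply, map_smul, map_smul,
      dproj₂_vliftVec]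
    rfl
  have dpair : MDiffAt (fun x ↦ P₂.pair x (α x) (β x)) p.2 :=
    mdifferentiableAt_form_apply hβ.mdifferentiableAt dα
  have hskew : α p.2 (P₂ p.2 (β p.2)) = - P₂.pair p.2 (α p.2) (β p.2) := by
    rw [hP₂.skew, neg_neg]; rfl
  refine cotangent_ext_fields (fun Y hY ↦ ?_) (fun Y hY ↦ ?_)
  · rw [formBracket_apply _ (smoothNear_vlift hα) (smoothNear_vlift hβ)
      (mdifferentiableAt_hfield hY), warpedBivector_vlift, warpedBivector_vlift, hpair,
      lieDerivEval_vfield_vlift_hfield dα hν hY, lieDerivEval_vfield_vlift_hfield dβ hν hY,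
      mvfderiv_fst_mul_snd hν dpair, hskew]
    simp only [add_apply, smul_apply, hcov_apply, vcov_apply, hfield, dproj₁_hliftVec,
      dproj₂_hliftVec, map_zero, smul_eq_mul, Anchor.pair]
    ring
  · rw [formBracket_apply _ (smoothNear_vlift hα) (smoothNear_vlift hβ)
      (mdifferentiableAt_vfield hY), warpedBivector_vlift, warpedBivector_vlift, hpair,
      lieDerivEval_vfield_vlift_vfield dα hν hβ hY, lieDerivEval_vfield_vlift_vfield dβ hν hα hY,
      mvfderiv_fst_mul_snd hν dpair]
    simp only [add_apply, smul_apply, hcov_apply, vcov_apply, vfield, dproj₁_vliftVec,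
      dproj₂_vliftVec, map_zero, smul_eq_mul,
      formBracket_apply P₂ hα hβ hY]
    ring

end Brackets

section WarpedConnection

variable {E₁ : Type*} [NormedAddCommGroup E₁] [NormedSpace ℝ E₁] [FiniteDimensional ℝ E₁]
  {H₁ : Type*} [TopologicalSpace H₁] {I₁ : ModelWithCorners ℝ E₁ H₁}
  {M₁ : Type*} [TopologicalSpace M₁] [ChartedSpace H₁ M₁] [IsManifold I₁ ∞ M₁]
  {E₂ : Type*} [NormedAddCommGroup E₂] [NormedSpace ℝ E₂] [FiniteDimensional ℝ E₂]
  {H₂ : Type*} [TopologicalSpace H₂] {I₂ : ModelWithCorners ℝ E₂ H₂}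
  {M₂ : Type*} [TopologicalSpace M₂] [ChartedSpace H₂ M₂] [IsManifold I₂ ∞ M₂]
  [I₁.Boundaryless] [I₂.Boundaryless]

/-- The data of a contravariant warped product, with its Levi-Civita connections. -/
structure IsWarpedProduct (f ν : M₁ → ℝ) (g₁ : BilinField I₁ M₁) (g₂ : BilinField I₂ M₂)
    (P₁ : Anchor I₁ M₁) (P₂ : Anchor I₂ M₂) (D₁ : ContraOp I₁ M₁) (D₂ : ContraOp I₂ M₂)
    (D : ContraOp (I₁.prod I₂) (M₁ × M₂)) : Prop where
  metric₁ : IsPseudoRiemannian g₁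
  metric₂ : IsPseudoRiemannian g₂
  poisson₁ : IsPoisson P₁
  poisson₂ : IsPoisson P₂
  smooth_f : ContMDiff I₁ 𝓘(ℝ, ℝ) ∞ f
  ne_zero : ∀ x, f x ≠ 0
  smooth_ν : ContMDiff I₁ 𝓘(ℝ, ℝ) ∞ ν
  leviCivita₁ : IsLeviCivita g₁ P₁ D₁
  leviCivita₂ : IsLeviCivita g₂ P₂ D₂
  leviCivita : IsLeviCivita (warpedMetric f g₁ g₂) (warpedBivector ν P₁ P₂) D

namespace IsWarpedProduct

variable {f ν : M₁ → ℝ} {g₁ : BilinField I₁ M₁} {g₂ : BilinField I₂ M₂}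
  {P₁ : Anchor I₁ M₁} {P₂ : Anchor I₂ M₂} {D₁ : ContraOp I₁ M₁} {D₂ : ContraOp I₂ M₂}
  {D : ContraOp (I₁.prod I₂) (M₁ × M₂)}
  (h : IsWarpedProduct f ν g₁ g₂ P₁ P₂ D₁ D₂ D) {p : M₁ × M₂}
include h

lemma hh (q : M₁ × M₂) (ξ η : Cotangent I₁ q.1) :
    cometric (warpedMetric f g₁ g₂) q (hcov q ξ) (hcov q η) = cometric g₁ q.1 ξ η :=
  cometric_hcov_hcov h.metric₁ h.metric₂ (h.ne_zero _) ξ η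

lemma hv (q : M₁ × M₂) (ξ : Cotangent I₁ q.1) (η : Cotangent I₂ q.2) :
    cometric (warpedMetric f g₁ g₂) q (hcov q ξ) (vcov q η) = 0 :=
  cometric_hcov_vcov h.metric₁ h.metric₂ (h.ne_zero _) ξ η

lemma vh (q : M₁ × M₂) (ξ : Cotangent I₂ q.2) (η : Cotangent I₁ q.1) :
    cometric (warpedMetric f g₁ g₂) q (vcov q ξ) (hcov q η) = 0 :=
  cometric_vcov_hcov h.metric₁ h.metric₂ (h.ne_zero _) ξ η

lemma vv (q : M₁ × M₂) (ξ η : Cotangent I₂ q.2) :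
    cometric (warpedMetric f g₁ g₂) q (vcov q ξ) (vcov q η)
      = (f q.1 ^ 2)⁻¹ * cometric g₂ q.2 ξ η := by
  rw [cometric_vcov_vcov h.metric₁ h.metric₂ (h.ne_zero _), div_eq_inv_mul]

lemma mdifferentiableAt_f (x : M₁) : MDiffAt f x := (h.smooth_f x).mdifferentiableAt (by simp)

lemma mdifferentiableAt_ν (x : M₁) : MDiffAt ν x := (h.smooth_ν x).mdifferentiableAt (by simp)

lemma symm (q : M₁ × M₂) (v w : TangentSpace (I₁.prod I₂) q) :
    warpedMetric f g₁ g₂ q v w = warpedMetric f g₁ g₂ q w v :=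
  warpedMetric_symm h.metric₁ h.metric₂ q v w

lemma ext {ξ η : Cotangent (I₁.prod I₂) p}
    (h₁ : ∀ γ : OneForm I₁ M₁, γ.SmoothNear p.1 →
      cometric (warpedMetric f g₁ g₂) p ξ (hlift γ p)
        = cometric (warpedMetric f g₁ g₂) p η (hlift γ p))
    (h₂ : ∀ γ : OneForm I₂ M₂, γ.SmoothNear p.2 →
      cometric (warpedMetric f g₁ g₂) p ξ (vlift γ p)
        = cometric (warpedMetric f g₁ g₂) p η (vlift γ p)) : ξ = η := by
  refine cotangent_prod_ext h.metric₁ h.metric₂ (h.ne_zero _) (fun γ ↦ ?_) (fun γ ↦ ?_)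
  · obtain ⟨γ', hγ', rfl⟩ := exists_smoothNear p.1 γ
    exact h₁ γ' hγ'
  · obtain ⟨γ', hγ', rfl⟩ := exists_smoothNear p.2 γ
    exact h₂ γ' hγ'

/-- Derivative of the cometric of two horizontal lifts. -/
lemma mvfderiv_hh {α β : OneForm I₁ M₁} (hα : α.SmoothNear p.1) (hβ : β.SmoothNear p.1) :
    mvfderiv (I₁.prod I₂) (fun q ↦ cometric (warpedMetric f g₁ g₂) q (hlift α q) (hlift β q)) p
      = hcov p (mvfderiv I₁ (fun x ↦ cometric g₁ x (α x) (β x)) p.1) := by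
  simp only [hlift_apply, h.hh]
  exact mvfderiv_comp_fst (mdifferentiableAt_cometric h.metric₁ hα hβ)

lemma mvfderiv_hv {α : OneForm I₁ M₁} {β : OneForm I₂ M₂} :
    mvfderiv (I₁.prod I₂) (fun q ↦ cometric (warpedMetric f g₁ g₂) q (hlift α q) (vlift β q)) p
      = 0 := by
  simp only [hlift_apply, vlift_apply, h.hv]
  exact mvfderiv_const 0

lemma mvfderiv_vh {α : OneForm I₁ M₁} {β : OneForm I₂ M₂} :
    mvfderiv (I₁.prod I₂) (fun q ↦ cometric (warpedMetric f g₁ g₂) q (vlift β q) (hlift α q)) p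
      = 0 := by
  simp only [hlift_apply, vlift_apply, h.vh]
  exact mvfderiv_const 0

/-- Derivative of the cometric of two vertical lifts. -/
lemma mvfderiv_vv {α β : OneForm I₂ M₂} (hα : α.SmoothNear p.2) (hβ : β.SmoothNear p.2) :
    mvfderiv (I₁.prod I₂) (fun q ↦ cometric (warpedMetric f g₁ g₂) q (vlift α q) (vlift β q)) p
      = (f p.1 ^ 2)⁻¹ • vcov p (mvfderiv I₂ (fun x ↦ cometric g₂ x (α x) (β x)) p.2)
        + (cometric g₂ p.2 (α p.2) (β p.2) * (-2 / f p.1 ^ 3)) • hcov p (mvfderiv I₁ f p.1) := by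
  have hd := hasDerivAt_sq_inv (h.ne_zero p.1)
  have e : mvfderiv I₁ (fun x ↦ (f x ^ 2)⁻¹) p.1 = (-2 / f p.1 ^ 3) • mvfderiv I₁ f p.1 :=
    ContinuousLinearMap.ext fun v ↦ mvfderiv_comp_hasDerivAt (φ := fun s ↦ (s ^ 2)⁻¹) hd (h.mdifferentiableAt_f p.1) v
  simp only [vlift_apply, h.vv]
  rw [mvfderiv_fst_mul_snd (u := fun x ↦ (f x ^ 2)⁻¹) (w := fun x ↦ cometric g₂ x (α x) (β x))
    (MDifferentiableAt.comp_hasDerivAt (φ := fun s ↦ (s ^ 2)⁻¹) hd (h.mdifferentiableAt_f p.1))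
    (mdifferentiableAt_cometric h.metric₂ hα hβ), e, map_smul, smul_smul]

lemma bracket_hh {α β : OneForm I₁ M₁} (hα : α.SmoothNear p.1) (hβ : β.SmoothNear p.1) :
    formBracket (warpedBivector ν P₁ P₂) (hlift (I₂ := I₂) α) (hlift β) p
      = hcov p (formBracket P₁ α β p.1) :=
  formBracket_hlift_hlift h.poisson₁ hα hβ

lemma bracket_hv {α : OneForm I₁ M₁} {β : OneForm I₂ M₂} (hα : α.SmoothNear p.1)
    (hβ : β.SmoothNear p.2) :
    formBracket (warpedBivector ν P₁ P₂) (hlift (I₂ := I₂) α) (vlift (I₁ := I₁) β) p = 0 :=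
  formBracket_hlift_vlift h.poisson₁ h.poisson₂ (h.mdifferentiableAt_ν _) hα hβ

lemma bracket_vh {α : OneForm I₁ M₁} {β : OneForm I₂ M₂} (hα : α.SmoothNear p.1)
    (hβ : β.SmoothNear p.2) :
    formBracket (warpedBivector ν P₁ P₂) (vlift (I₁ := I₁) β) (hlift (I₂ := I₂) α) p = 0 := by
  rw [h.leviCivita.formBracket_swap (smoothNear_hlift hα) (smoothNear_vlift hβ),
    h.bracket_hv hα hβ, neg_zero]

lemma bracket_vv {α β : OneForm I₂ M₂} (hα : α.SmoothNear p.2) (hβ : β.SmoothNear p.2) :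
    formBracket (warpedBivector ν P₁ P₂) (vlift (I₁ := I₁) α) (vlift β) p
      = ν p.1 • vcov p (formBracket P₂ α β p.2)
        + P₂.pair p.2 (α p.2) (β p.2) • hcov p (mvfderiv I₁ ν p.1) :=
  formBracket_vlift_vlift h.poisson₂ (h.mdifferentiableAt_ν _) hα hβ

lemma deriv_hh {α β : OneForm I₁ M₁} (hα : α.SmoothNear p.1) (hβ : β.SmoothNear p.1) :
    D.deriv (hlift α) (hlift β) p = hcov p (D₁.deriv α β p.1) := by
  refine h.ext (fun γ hγ ↦ ?_) (fun γ hγ ↦ ?_)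
  · have k := h.leviCivita.koszul h.symm (smoothNear_hlift hα) (smoothNear_hlift hβ) (smoothNear_hlift hγ)
    rw [h.mvfderiv_hh hβ hγ, h.mvfderiv_hh hγ hα, h.mvfderiv_hh hα hβ, h.bracket_hh hα hβ,
      h.bracket_hh hα hγ, h.bracket_hh hβ hγ] at k
    simp only [hlift_apply, warpedBivector_hcov, hcov_apply, dproj₁_hliftVec, h.hh] at k
    have k₁ := h.leviCivita₁.koszul h.metric₁.symm hα hβ hγ
    rw [hlift_apply, h.hh]
    linarith
  · have k := h.leviCivita.koszul h.symm (smoothNear_hlift hα) (smoothNear_hlift hβ) (smoothNear_vlift hγ)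
    rw [h.mvfderiv_hv, h.mvfderiv_vh, h.mvfderiv_hh hα hβ, h.bracket_hh hα hβ,
      h.bracket_hv hα hγ, h.bracket_hv hβ hγ] at k
    simp only [hlift_apply, vlift_apply, warpedBivector_vcov, hcov_apply, map_smul,
      dproj₁_vliftVec, map_zero, smul_zero, h.hv, cometric_zero_left, zero_apply] at k
    rw [vlift_apply, h.hv]
    linarith

lemma deriv_hv {α : OneForm I₁ M₁} {β : OneForm I₂ M₂} (hα : α.SmoothNear p.1)
    (hβ : β.SmoothNear p.2) :
    D.deriv (hlift α) (vlift β) p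
      = (cometric g₁ p.1 (Jd g₁ P₁ f p.1) (α p.1) / f p.1) • vcov p (β p.2)
        - (f p.1 ^ 2 / 2 * cometric g₁ p.1 (mvfderiv I₁ ν p.1) (α p.1)) •
          vcov p (fieldEndo g₂ P₂ p.2 (β p.2)) := by
  have hf := h.ne_zero p.1
  refine h.ext (fun γ hγ ↦ ?_) (fun γ hγ ↦ ?_)
  · have k := h.leviCivita.koszul h.symm (smoothNear_hlift hα) (smoothNear_vlift hβ) (smoothNear_hlift hγ)
    rw [h.mvfderiv_vh, h.mvfderiv_hh hγ hα, h.mvfderiv_hv, h.bracket_hv hα hβ,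
      h.bracket_hh hα hγ, h.bracket_vh hγ hβ] at k
    simp only [hlift_apply, vlift_apply, warpedBivector_vcov, hcov_apply, map_smul,
      dproj₁_vliftVec, map_zero, smul_zero, h.hv, cometric_zero_left, zero_apply] at k
    simp only [hlift_apply, cometric_sub_left, cometric_smul_left, h.vh]
    linarith
  · have k := h.leviCivita.koszul h.symm (smoothNear_hlift hα) (smoothNear_vlift hβ) (smoothNear_vlift hγ)
    rw [h.mvfderiv_vv hβ hγ, h.mvfderiv_vh, h.mvfderiv_hv, h.bracket_hv hα hβ,
      h.bracket_hv hα hγ, h.bracket_vv hβ hγ] at k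
    simp only [hlift_apply, vlift_apply, warpedBivector_hcov, hcov_apply, vcov_apply, add_apply,
      smul_apply, dproj₁_hliftVec, dproj₂_hliftVec, map_zero, h.hh, h.vh,
      cometric_zero_left, cometric_add_left, cometric_smul_left, zero_apply, smul_eq_mul,
      mvfderiv_anchor_apply h.metric₁ h.poisson₁] at k
    simp only [vlift_apply, cometric_sub_left, cometric_smul_left, h.vv,
      cometric_fieldEndo h.metric₂]
    refine mul_left_cancel₀ two_ne_zero (k.trans ?_)
    field_simp
    ring

lemma deriv_vh {α : OneForm I₁ M₁} {β : OneForm I₂ M₂} (hα : α.SmoothNear p.1)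
    (hβ : β.SmoothNear p.2) :
    D.deriv (vlift β) (hlift α) p
      = (cometric g₁ p.1 (Jd g₁ P₁ f p.1) (α p.1) / f p.1) • vcov p (β p.2)
        - (f p.1 ^ 2 / 2 * cometric g₁ p.1 (mvfderiv I₁ ν p.1) (α p.1)) •
          vcov p (fieldEndo g₂ P₂ p.2 (β p.2)) := by
  have k := h.leviCivita.deriv_sub (smoothNear_vlift hβ) (smoothNear_hlift hα)
  rw [h.bracket_vh hα hβ, sub_eq_zero] at k
  rw [k, h.deriv_hv hα hβ]

lemma deriv_vv {α β : OneForm I₂ M₂} (hα : α.SmoothNear p.2) (hβ : β.SmoothNear p.2) :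
    D.deriv (vlift α) (vlift β) p
      = ν p.1 • vcov p (D₂.deriv α β p.2)
        - (cometric g₂ p.2 (α p.2) (β p.2) / f p.1 ^ 3) • hcov p (Jd g₁ P₁ f p.1)
        + (P₂.pair p.2 (α p.2) (β p.2) / 2) • hcov p (mvfderiv I₁ ν p.1) := by
  have hf := h.ne_zero p.1
  refine h.ext (fun γ hγ ↦ ?_) (fun γ hγ ↦ ?_)
  · have k := h.leviCivita.koszul h.symm (smoothNear_vlift hα) (smoothNear_vlift hβ)
      (smoothNear_hlift hγ)
    rw [h.mvfderiv_vh, h.mvfderiv_hv, h.mvfderiv_vv hα hβ, h.bracket_vv hα hβ,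
      h.bracket_vh hγ hα, h.bracket_vh hγ hβ] at k
    simp only [hlift_apply, warpedBivector_hcov, hcov_apply, vcov_apply, add_apply,
      smul_apply, dproj₁_hliftVec, dproj₂_hliftVec, map_zero, h.hh, h.vh,
      cometric_zero_left, cometric_add_left, cometric_smul_left, zero_apply, smul_eq_mul,
      mvfderiv_anchor_apply h.metric₁ h.poisson₁] at k
    simp only [hlift_apply, cometric_sub_left, cometric_add_left, cometric_smul_left, h.hh, h.vh]
    refine mul_left_cancel₀ two_ne_zero (k.trans ?_)
    field_simp
    ring
  · have k := h.leviCivita.koszul h.symm (smoothNear_vlift hα) (smoothNear_vlift hβ)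
      (smoothNear_vlift hγ)
    have k₂ := h.leviCivita₂.koszul h.metric₂.symm hα hβ hγ
    rw [h.mvfderiv_vv hβ hγ, h.mvfderiv_vv hγ hα, h.mvfderiv_vv hα hβ, h.bracket_vv hα hβ,
      h.bracket_vv hα hγ, h.bracket_vv hβ hγ] at k
    simp only [vlift_apply, warpedBivector_vcov, hcov_apply, vcov_apply, add_apply,
      smul_apply, dproj₁_vliftVec, dproj₂_vliftVec, map_zero, map_smul, h.vv, h.hv,
      cometric_add_left, cometric_smul_left, smul_eq_mul] at k
    simp only [vlift_apply, cometric_sub_left, cometric_add_left, cometric_smul_left, h.hv, h.vv]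
    refine mul_left_cancel₀ two_ne_zero (k.trans ?_)
    linear_combination (-(f p.1 ^ 2)⁻¹ * ν p.1) * k₂

end IsWarpedProduct
end WarpedConnection

section Eventually

variable {E : Type*} [NormedAddCommGroup E] [NormedSpace ℝ E]
  {H : Type*} [TopologicalSpace H] {I : ModelWithCorners ℝ E H}
  {M : Type*} [TopologicalSpace M] [ChartedSpace H M]

lemma mvfderiv_congr_of_eventuallyEq {u w : M → ℝ} {x : M} (h : u =ᶠ[𝓝 x] w) :
    mvfderiv I u x = mvfderiv I w x := by
  refine ContinuousLinearMap.ext fun v ↦ ?_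
  exact congrArg (fun A : TangentSpace I x →L[ℝ] ℝ ↦ A v) h.mfderiv_eq

end Eventually

section WarpedCurvature

variable {E₁ : Type*} [NormedAddCommGroup E₁] [NormedSpace ℝ E₁] [FiniteDimensional ℝ E₁]
  {H₁ : Type*} [TopologicalSpace H₁] {I₁ : ModelWithCorners ℝ E₁ H₁}
  {M₁ : Type*} [TopologicalSpace M₁] [ChartedSpace H₁ M₁] [IsManifold I₁ ∞ M₁]
  {E₂ : Type*} [NormedAddCommGroup E₂] [NormedSpace ℝ E₂] [FiniteDimensional ℝ E₂]
  {H₂ : Type*} [TopologicalSpace H₂] {I₂ : ModelWithCorners ℝ E₂ H₂}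
  {M₂ : Type*} [TopologicalSpace M₂] [ChartedSpace H₂ M₂] [IsManifold I₂ ∞ M₂]
  [I₁.Boundaryless] [I₂.Boundaryless]

namespace IsWarpedProduct

variable {f ν : M₁ → ℝ} {g₁ : BilinField I₁ M₁} {g₂ : BilinField I₂ M₂}
  {P₁ : Anchor I₁ M₁} {P₂ : Anchor I₂ M₂} {D₁ : ContraOp I₁ M₁} {D₂ : ContraOp I₂ M₂}
  {D : ContraOp (I₁.prod I₂) (M₁ × M₂)}
  (h : IsWarpedProduct f ν g₁ g₂ P₁ P₂ D₁ D₂ D) {p : M₁ × M₂}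
include h

lemma pair_self (x : M₂) (ξ : Cotangent I₂ x) : P₂.pair x ξ ξ = 0 := by
  linarith [h.poisson₂.skew x ξ ξ]

lemma smoothNear_scaledVlift {β : OneForm I₂ M₂} (hβ : β.SmoothNear p.2) :
    (scaledVlift (I₁ := I₁) f β : OneForm (I₁.prod I₂) (M₁ × M₂)).SmoothNear p := by
  filter_upwards [smoothNear_vlift (I₁ := I₁) hβ] with q hq
  exact ContMDiffAt.smul_section (s := vlift (I₁ := I₁) β) (f := fun q : M₁ × M₂ ↦ f q.1)
    ((h.smooth_f.contMDiffAt (x := q.1)).comp q contMDiffAt_fst) hq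

/-- The Leibniz rule for the scaled vertical lift. -/
lemma deriv_scaled {α : OneForm (I₁.prod I₂) (M₁ × M₂)} {β : OneForm I₂ M₂} (hα : α.SmoothNear p)
    (hβ : β.SmoothNear p.2) :
    D.deriv α (scaledVlift f β) p = f p.1 • D.deriv α (vlift β) p
      + hcov p (mvfderiv I₁ f p.1) (warpedBivector ν P₁ P₂ p (α p)) • vcov p (β p.2) := by
  rw [← mvfderiv_comp_fst (h.mdifferentiableAt_f p.1)]
  exact h.leviCivita.leibniz α (vlift β) (fun q ↦ f q.1) p hα (smoothNear_vlift hβ)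
    (Filter.Eventually.of_forall fun q ↦ (h.smooth_f.contMDiffAt (x := q.1)).comp q contMDiffAt_fst)

lemma deriv_scaled_left {α : OneForm (I₁.prod I₂) (M₁ × M₂)} {β : OneForm I₂ M₂} :
    D.deriv (scaledVlift f β) α p = f p.1 • D.deriv (vlift β) α p :=
  map_smul (D α p) (f p.1) (vcov p (β p.2))

lemma deriv_hs {α : OneForm I₁ M₁} {β : OneForm I₂ M₂} (hα : α.SmoothNear p.1)
    (hβ : β.SmoothNear p.2) :
    D.deriv (hlift α) (scaledVlift f β) p
      = (-(f p.1 ^ 3 / 2 * cometric g₁ p.1 (mvfderiv I₁ ν p.1) (α p.1))) •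
          vcov p (fieldEndo g₂ P₂ p.2 (β p.2)) := by
  have hf := h.ne_zero p.1
  rw [h.deriv_scaled (smoothNear_hlift hα) hβ, h.deriv_hv hα hβ, hlift_apply,
    warpedBivector_hcov, hcov_apply, dproj₁_hliftVec,
    mvfderiv_anchor_apply h.metric₁ h.poisson₁]
  match_scalars <;> field_simp
  ring

lemma deriv_sh {α : OneForm I₁ M₁} {β : OneForm I₂ M₂} (hα : α.SmoothNear p.1)
    (hβ : β.SmoothNear p.2) :
    D.deriv (scaledVlift f β) (hlift α) p
      = cometric g₁ p.1 (Jd g₁ P₁ f p.1) (α p.1) • vcov p (β p.2)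
        - (f p.1 ^ 3 / 2 * cometric g₁ p.1 (mvfderiv I₁ ν p.1) (α p.1)) •
          vcov p (fieldEndo g₂ P₂ p.2 (β p.2)) := by
  have hf := h.ne_zero p.1
  rw [h.deriv_scaled_left, h.deriv_vh hα hβ]
  match_scalars <;> field_simp

lemma deriv_vs {α β : OneForm I₂ M₂} (hα : α.SmoothNear p.2) (hβ : β.SmoothNear p.2) :
    D.deriv (vlift α) (scaledVlift f β) p
      = (f p.1 * ν p.1) • vcov p (D₂.deriv α β p.2)
        - (cometric g₂ p.2 (α p.2) (β p.2) / f p.1 ^ 2) • hcov p (Jd g₁ P₁ f p.1)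
        + (f p.1 * P₂.pair p.2 (α p.2) (β p.2) / 2) • hcov p (mvfderiv I₁ ν p.1) := by
  have hf := h.ne_zero p.1
  rw [h.deriv_scaled (smoothNear_vlift hα) hβ, h.deriv_vv hα hβ, vlift_apply,
    warpedBivector_vcov, hcov_apply, map_smul, dproj₁_vliftVec]
  simp only [map_zero, smul_zero, zero_smul, add_zero]
  match_scalars <;> field_simp

lemma deriv_ss {α β : OneForm I₂ M₂} (hα : α.SmoothNear p.2) (hβ : β.SmoothNear p.2) :
    D.deriv (scaledVlift f α) (scaledVlift f β) p
      = (f p.1 ^ 2 * ν p.1) • vcov p (D₂.deriv α β p.2)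
        - (cometric g₂ p.2 (α p.2) (β p.2) / f p.1) • hcov p (Jd g₁ P₁ f p.1)
        + (f p.1 ^ 2 * P₂.pair p.2 (α p.2) (β p.2) / 2) • hcov p (mvfderiv I₁ ν p.1) := by
  have hf := h.ne_zero p.1
  rw [h.deriv_scaled_left, h.deriv_vs hα hβ]
  match_scalars <;> field_simp

lemma bracket_hs {α : OneForm I₁ M₁} {β : OneForm I₂ M₂} (hα : α.SmoothNear p.1)
    (hβ : β.SmoothNear p.2) :
    formBracket (warpedBivector ν P₁ P₂) (hlift α) (scaledVlift f β) p
      = (-cometric g₁ p.1 (Jd g₁ P₁ f p.1) (α p.1)) • vcov p (β p.2) := by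
  rw [← h.leviCivita.deriv_sub (smoothNear_hlift hα) (h.smoothNear_scaledVlift hβ),
    h.deriv_hs hα hβ, h.deriv_sh hα hβ]
  module

lemma bracket_sh {α : OneForm I₁ M₁} {β : OneForm I₂ M₂} (hα : α.SmoothNear p.1)
    (hβ : β.SmoothNear p.2) :
    formBracket (warpedBivector ν P₁ P₂) (scaledVlift f β) (hlift α) p
      = cometric g₁ p.1 (Jd g₁ P₁ f p.1) (α p.1) • vcov p (β p.2) := by
  rw [h.leviCivita.formBracket_swap (smoothNear_hlift hα) (h.smoothNear_scaledVlift hβ),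
    h.bracket_hs hα hβ]
  module

lemma bracket_ss {α β : OneForm I₂ M₂} (hα : α.SmoothNear p.2) (hβ : β.SmoothNear p.2) :
    formBracket (warpedBivector ν P₁ P₂) (scaledVlift f α) (scaledVlift f β) p
      = (f p.1 ^ 2 * ν p.1) • vcov p (formBracket P₂ α β p.2)
        + (f p.1 ^ 2 * P₂.pair p.2 (α p.2) (β p.2)) • hcov p (mvfderiv I₁ ν p.1) := by
  rw [← h.leviCivita.deriv_sub (h.smoothNear_scaledVlift hα) (h.smoothNear_scaledVlift hβ),
    h.deriv_ss hα hβ, h.deriv_ss hβ hα, ← h.leviCivita₂.deriv_sub hα hβ,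
    h.poisson₂.skew p.2 (β p.2) (α p.2), cometric_comm h.metric₂ p.2 (β p.2) (α p.2), map_sub]
  module

/-- The derivative of a scaled vertical lift along a vertical covector. -/
lemma op_vs {β : OneForm I₂ M₂} (hβ : β.SmoothNear p.2) (ξ : Cotangent I₂ p.2) :
    D (scaledVlift f β) p (vcov p ξ)
      = (f p.1 * ν p.1) • vcov p (D₂ β p.2 ξ)
        - (cometric g₂ p.2 ξ (β p.2) / f p.1 ^ 2) • hcov p (Jd g₁ P₁ f p.1)
        + (f p.1 * P₂.pair p.2 ξ (β p.2) / 2) • hcov p (mvfderiv I₁ ν p.1) := by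
  obtain ⟨α, hα, rfl⟩ := exists_smoothNear p.2 ξ
  exact h.deriv_vs hα hβ

/-- The derivative of a scaled vertical lift along a horizontal covector. -/
lemma op_hs {β : OneForm I₂ M₂} (hβ : β.SmoothNear p.2) (ξ : Cotangent I₁ p.1) :
    D (scaledVlift f β) p (hcov p ξ)
      = (-(f p.1 ^ 3 / 2 * cometric g₁ p.1 (mvfderiv I₁ ν p.1) ξ)) •
          vcov p (fieldEndo g₂ P₂ p.2 (β p.2)) := by
  obtain ⟨α, hα, rfl⟩ := exists_smoothNear p.1 ξ
  exact h.deriv_hs hα hβ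

/-- The derivative of a horizontal lift along a vertical covector. -/
lemma op_vh {α : OneForm I₁ M₁} (hα : α.SmoothNear p.1) (ξ : Cotangent I₂ p.2) :
    D (hlift α) p (vcov p ξ)
      = (cometric g₁ p.1 (Jd g₁ P₁ f p.1) (α p.1) / f p.1) • vcov p ξ
        - (f p.1 ^ 2 / 2 * cometric g₁ p.1 (mvfderiv I₁ ν p.1) (α p.1)) •
          vcov p (fieldEndo g₂ P₂ p.2 ξ) := by
  obtain ⟨β, hβ, rfl⟩ := exists_smoothNear p.2 ξ
  exact h.deriv_vh hα hβ

end IsWarpedProduct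
end WarpedCurvature

section WarpedSectional

variable {E₁ : Type*} [NormedAddCommGroup E₁] [NormedSpace ℝ E₁] [FiniteDimensional ℝ E₁]
  {H₁ : Type*} [TopologicalSpace H₁] {I₁ : ModelWithCorners ℝ E₁ H₁}
  {M₁ : Type*} [TopologicalSpace M₁] [ChartedSpace H₁ M₁] [IsManifold I₁ ∞ M₁]
  {E₂ : Type*} [NormedAddCommGroup E₂] [NormedSpace ℝ E₂] [FiniteDimensional ℝ E₂]
  {H₂ : Type*} [TopologicalSpace H₂] {I₂ : ModelWithCorners ℝ E₂ H₂}
  {M₂ : Type*} [TopologicalSpace M₂] [ChartedSpace H₂ M₂] [IsManifold I₂ ∞ M₂]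
  [I₁.Boundaryless] [I₂.Boundaryless]

lemma ContraOp.apply_smul (D : ContraOp I₁ M₁) (η : OneForm I₁ M₁) (x : M₁) (c : ℝ)
    (ξ : Cotangent I₁ x) : D η x (c • ξ) = c • D η x ξ :=
  ContinuousLinearMap.map_smul _ _ _

lemma ContraOp.apply_add (D : ContraOp I₁ M₁) (η : OneForm I₁ M₁) (x : M₁)
    (ξ ζ : Cotangent I₁ x) : D η x (ξ + ζ) = D η x ξ + D η x ζ :=
  ContinuousLinearMap.map_add _ _ _

namespace IsWarpedProduct

variable {f ν : M₁ → ℝ} {g₁ : BilinField I₁ M₁} {g₂ : BilinField I₂ M₂}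
  {P₁ : Anchor I₁ M₁} {P₂ : Anchor I₂ M₂} {D₁ : ContraOp I₁ M₁} {D₂ : ContraOp I₂ M₂}
  {D : ContraOp (I₁.prod I₂) (M₁ × M₂)}
  (h : IsWarpedProduct f ν g₁ g₂ P₁ P₂ D₁ D₂ D) {p : M₁ × M₂}
include h

lemma smoothNear_Jd_f (x : M₁) : (Jd g₁ P₁ f).SmoothNear x :=
  smoothNear_Jd h.metric₁ h.poisson₁ (Filter.Eventually.of_forall fun y ↦ h.smooth_f y)

/-- `(♯α)(g̃₁(J₁ df, α)) = H^f(α, α) + g̃₁(J₁ df, 𝒟_α α)`. -/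
lemma mvfderiv_cometric_Jd {x : M₁} {α : OneForm I₁ M₁} (hα : α.SmoothNear x) :
    mvfderiv I₁ (fun y ↦ cometric g₁ y (Jd g₁ P₁ f y) (α y)) x (P₁ x (α x))
      = hessian g₁ P₁ D₁ f α α x + cometric g₁ x (Jd g₁ P₁ f x) (D₁.deriv α α x) :=
  h.leviCivita₁.metric α _ α x hα (h.smoothNear_Jd_f x) hα

lemma secondDeriv_eq {x : M₁} {α : OneForm I₁ M₁} (hα : α.SmoothNear x) :
    secondDeriv P₁ D₁ f α α x = -hessian g₁ P₁ D₁ f α α x := by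
  have e : mvfderiv I₁ (fun y ↦ mvfderiv I₁ f y (P₁ y (α y))) x
      = -mvfderiv I₁ (fun y ↦ cometric g₁ y (Jd g₁ P₁ f y) (α y)) x := by
    simp only [mvfderiv_anchor_apply h.metric₁ h.poisson₁]
    exact mvfderiv_neg
  rw [secondDeriv, e, neg_apply, h.mvfderiv_cometric_Jd hα,
    mvfderiv_anchor_apply h.metric₁ h.poisson₁]
  ring

lemma op_hh {β : OneForm I₁ M₁} (hβ : β.SmoothNear p.1) (ξ : Cotangent I₁ p.1) :
    D (hlift β) p (hcov p ξ) = hcov p (D₁ β p.1 ξ) := by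
  obtain ⟨α, hα, rfl⟩ := exists_smoothNear p.1 ξ
  exact h.deriv_hh hα hβ

lemma mvfderiv_deriv_hh {α β γ : OneForm I₁ M₁} (hα : α.SmoothNear p.1) (hβ : β.SmoothNear p.1)
    (hγ : γ.SmoothNear p.1) (ξ : Cotangent I₁ p.1) :
    mvfderiv (I₁.prod I₂) (fun q ↦ cometric (warpedMetric f g₁ g₂) q
        (D.deriv (hlift α) (hlift β) q) (hlift γ q)) p (warpedBivector ν P₁ P₂ p (hcov p ξ))
      = mvfderiv I₁ (fun x ↦ cometric g₁ x (D₁.deriv α β x) (γ x)) p.1 (P₁ p.1 ξ) := by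
  have e : (fun q ↦ cometric (warpedMetric f g₁ g₂) q (D.deriv (hlift α) (hlift β) q) (hlift γ q))
      =ᶠ[𝓝 p] fun q ↦ cometric g₁ q.1 (D₁.deriv α β q.1) (γ q.1) := by
    filter_upwards [continuousAt_fst.eventually hα.eventually,
      continuousAt_fst.eventually hβ.eventually] with q h1 h2
    rw [h.deriv_hh h1 h2, hlift_apply, h.hh]
  rw [mvfderiv_congr_of_eventuallyEq e, mvfderiv_comp_fst
    (mdifferentiableAt_cometric h.metric₁ (h.leviCivita₁.smooth α β p.1 hα hβ) hγ),
    warpedBivector_hcov, hcov_apply, dproj₁_hliftVec]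

/-- The numerator of the sectional curvature of two horizontal lifts. -/
lemma cometric_curvature_hh {α β : OneForm I₁ M₁} (hα : α.SmoothNear p.1)
    (hβ : β.SmoothNear p.1) :
    cometric (warpedMetric f g₁ g₂) p
        (curvature (warpedBivector ν P₁ P₂) D (hlift α) (hlift β) (hlift β) p) (hlift α p)
      = cometric g₁ p.1 (curvature P₁ D₁ α β β p.1) (α p.1) := by
  rw [h.leviCivita.cometric_curvature (smoothNear_hlift hα) (smoothNear_hlift hβ),
    h.leviCivita₁.cometric_curvature hα hβ, hlift_apply α, hlift_apply β,
    h.mvfderiv_deriv_hh hβ hβ hα, h.mvfderiv_deriv_hh hα hβ hα, h.deriv_hh hβ hβ,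
    h.deriv_hh hα hα, h.deriv_hh hα hβ, h.deriv_hh hβ hα, h.bracket_hh hα hβ, h.op_hh hβ,
    h.hh, h.hh, h.hh]

lemma sectionalCurvature_hh {α β : OneForm I₁ M₁} (hα : α.SmoothNear p.1)
    (hβ : β.SmoothNear p.1) :
    sectionalCurvature (warpedMetric f g₁ g₂) (warpedBivector ν P₁ P₂) D (hlift α) (hlift β) p
      = sectionalCurvature g₁ P₁ D₁ α β p.1 := by
  rw [sectionalCurvature, h.cometric_curvature_hh hα hβ, hlift_apply, hlift_apply, h.hh, h.hh,
    h.hh, sectionalCurvature]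

/-! ### Scaled vertical lifts -/

lemma cometric_vcov_scaledVlift (q : M₁ × M₂) (ξ : Cotangent I₂ q.2) (β : OneForm I₂ M₂) :
    cometric (warpedMetric f g₁ g₂) q (vcov q ξ) (scaledVlift f β q)
      = cometric g₂ q.2 ξ (β q.2) / f q.1 := by
  have hf := h.ne_zero q.1
  rw [scaledVlift_apply, cometric_smul_right, h.vv]
  field_simp

lemma cometric_hcov_scaledVlift (q : M₁ × M₂) (ξ : Cotangent I₁ q.1) (β : OneForm I₂ M₂) :
    cometric (warpedMetric f g₁ g₂) q (hcov q ξ) (scaledVlift f β q) = 0 := by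
  rw [scaledVlift_apply, cometric_smul_right, h.hv, mul_zero]

lemma cometric_scaledVlift (q : M₁ × M₂) (α β : OneForm I₂ M₂) :
    cometric (warpedMetric f g₁ g₂) q (scaledVlift f α q) (scaledVlift f β q)
      = cometric g₂ q.2 (α q.2) (β q.2) := by
  have hf := h.ne_zero q.1
  rw [scaledVlift_apply f α, cometric_smul_left, h.cometric_vcov_scaledVlift]
  field_simp

lemma mdifferentiableAt_const_mul_div_f {u : M₁ → ℝ} {x : M₁} (hu : MDiffAt u x) (c : ℝ) :
    MDiffAt (fun y ↦ c * (u y / f y)) x :=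
  (mdifferentiableAt_const (c := c)).mul (hu.mul
    (MDifferentiableAt.comp_hasDerivAt (hasDerivAt_inv (h.ne_zero x)) (h.mdifferentiableAt_f x)))

lemma mvfderiv_const_mul_div_f {u : M₁ → ℝ} {x : M₁} (hu : MDiffAt u x) (c : ℝ)
    (v : TangentSpace I₁ x) :
    mvfderiv I₁ (fun y ↦ c * (u y / f y)) x v
      = c * (mvfderiv I₁ u x v / f x - u x * mvfderiv I₁ f x v / f x ^ 2) := by
  have hf := h.ne_zero x
  have hi := hasDerivAt_inv hf
  have e : (fun y ↦ c * (u y / f y)) = (fun y ↦ c * u y) * fun y ↦ (f y)⁻¹ := by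
    funext y
    simp only [Pi.mul_apply]
    ring
  have d : MDiffAt (fun y ↦ c * u y) x := mdifferentiableAt_const.mul hu
  have e' : (fun y ↦ c * u y) = (fun _ ↦ c) * u := rfl
  rw [e, mvfderiv_mul d (MDifferentiableAt.comp_hasDerivAt hi (h.mdifferentiableAt_f x)), e',
    mvfderiv_mul mdifferentiableAt_const hu, mvfderiv_const]
  simp only [add_apply, smul_apply, smul_eq_mul, zero_apply, mul_zero, add_zero,
    mvfderiv_comp_hasDerivAt hi (h.mdifferentiableAt_f x)]
  field_simp
  ring

/-- The numerator of the sectional curvature of a horizontal lift and a scaled vertical lift. -/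
lemma cometric_curvature_hs {α : OneForm I₁ M₁} {β : OneForm I₂ M₂} {ε : ℝ}
    (hα : α.SmoothNear p.1) (hβ : β.SmoothNear p.2)
    (hε : ∀ᶠ y in 𝓝 p.2, cometric g₂ y (β y) (β y) = ε) :
    cometric (warpedMetric f g₁ g₂) p
        (curvature (warpedBivector ν P₁ P₂) D (hlift α) (scaledVlift f β) (scaledVlift f β) p)
        (hlift α p)
      = -ε * hessian g₁ P₁ D₁ f α α p.1 / f p.1
        - 2 * ε * cometric g₁ p.1 (Jd g₁ P₁ f p.1) (α p.1) ^ 2 / f p.1 ^ 2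
        + f p.1 ^ 4 / 4 * cometric g₁ p.1 (mvfderiv I₁ ν p.1) (α p.1) ^ 2
          * normSq g₂ p.2 (fieldEndo g₂ P₂ p.2 (β p.2)) := by
  have hf := h.ne_zero p.1
  have eα := (continuousAt_fst (p := p)).eventually hα.eventually
  have eβ := (continuousAt_snd (p := p)).eventually hβ.eventually
  have e1 : (fun q ↦ cometric (warpedMetric f g₁ g₂) q
        (D.deriv (scaledVlift f β) (scaledVlift f β) q) (hlift α q))
      =ᶠ[𝓝 p] fun q ↦ -ε * (cometric g₁ q.1 (Jd g₁ P₁ f q.1) (α q.1) / f q.1) := by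
    filter_upwards [eβ, (continuousAt_snd (p := p)).eventually hε] with q h1 h2
    rw [h.deriv_ss h1 h1, hlift_apply, h.pair_self, h2]
    simp only [cometric_add_left, cometric_sub_left, cometric_smul_left, h.hh, h.vh]
    ring
  have e3 : (fun q ↦ cometric (warpedMetric f g₁ g₂) q
        (D.deriv (hlift α) (scaledVlift f β) q) (hlift α q)) =ᶠ[𝓝 p] fun _ ↦ 0 := by
    filter_upwards [eα, eβ] with q h1 h2
    rw [h.deriv_hs h1 h2, hlift_apply, cometric_smul_left, h.vh, mul_zero]
  have d := mdifferentiableAt_cometric h.metric₁ (h.smoothNear_Jd_f p.1) hα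
  have d' : MDiffAt (fun x ↦ -ε * (cometric g₁ x (Jd g₁ P₁ f x) (α x) / f x)) p.1 :=
    h.mdifferentiableAt_const_mul_div_f d (-ε)
  rw [h.leviCivita.cometric_curvature (smoothNear_hlift hα) (h.smoothNear_scaledVlift hβ),
    mvfderiv_congr_of_eventuallyEq e1, mvfderiv_congr_of_eventuallyEq e3, mvfderiv_const,
    mvfderiv_comp_fst d', h.deriv_ss hβ hβ, h.deriv_hh hα hα, h.deriv_hs hα hβ, h.deriv_sh hα hβ,
    h.bracket_hs hα hβ, D.apply_smul, h.op_vs hβ, h.pair_self, hε.self_of_nhds, hlift_apply,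
    warpedBivector_hcov, hcov_apply, dproj₁_hliftVec, h.mvfderiv_const_mul_div_f d,
    h.mvfderiv_cometric_Jd hα, mvfderiv_anchor_apply h.metric₁ h.poisson₁]
  simp only [cometric_add_left, cometric_sub_left, cometric_sub_right, cometric_smul_left,
    cometric_smul_right, h.hh, h.vh, h.vv, zero_apply, cometric_fieldEndo h.metric₂, normSq]
  rw [h.pair_self]
  field_simp
  ring

/-- The numerator of the sectional curvature of a scaled vertical lift and a horizontal lift. -/
lemma cometric_curvature_sh {α : OneForm I₁ M₁} {β : OneForm I₂ M₂} {ε : ℝ}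
    (hα : α.SmoothNear p.1) (hβ : β.SmoothNear p.2)
    (hε : ∀ᶠ y in 𝓝 p.2, cometric g₂ y (β y) (β y) = ε) :
    cometric (warpedMetric f g₁ g₂) p
        (curvature (warpedBivector ν P₁ P₂) D (scaledVlift f β) (hlift α) (hlift α) p)
        (scaledVlift f β p)
      = -ε * hessian g₁ P₁ D₁ f α α p.1 / f p.1
        - 2 * ε * cometric g₁ p.1 (Jd g₁ P₁ f p.1) (α p.1) ^ 2 / f p.1 ^ 2
        + f p.1 ^ 4 / 4 * cometric g₁ p.1 (mvfderiv I₁ ν p.1) (α p.1) ^ 2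
          * normSq g₂ p.2 (fieldEndo g₂ P₂ p.2 (β p.2)) := by
  have hf := h.ne_zero p.1
  have eα := (continuousAt_fst (p := p)).eventually hα.eventually
  have eβ := (continuousAt_snd (p := p)).eventually hβ.eventually
  have e1 : (fun q ↦ cometric (warpedMetric f g₁ g₂) q
        (D.deriv (hlift α) (hlift α) q) (scaledVlift f β q)) =ᶠ[𝓝 p] fun _ ↦ 0 := by
    filter_upwards [eα] with q h1
    rw [h.deriv_hh h1 h1, h.cometric_hcov_scaledVlift]
  have e3 : (fun q ↦ cometric (warpedMetric f g₁ g₂) q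
        (D.deriv (scaledVlift f β) (hlift α) q) (scaledVlift f β q))
      =ᶠ[𝓝 p] fun q ↦ ε * (cometric g₁ q.1 (Jd g₁ P₁ f q.1) (α q.1) / f q.1) := by
    filter_upwards [eα, eβ, (continuousAt_snd (p := p)).eventually hε] with q h1 h2 h3
    rw [h.deriv_sh h1 h2]
    simp only [cometric_sub_left, cometric_smul_left, h.cometric_vcov_scaledVlift,
      cometric_fieldEndo h.metric₂, h.pair_self, h3]
    ring
  have d := mdifferentiableAt_cometric h.metric₁ (h.smoothNear_Jd_f p.1) hα
  have d' : MDiffAt (fun x ↦ ε * (cometric g₁ x (Jd g₁ P₁ f x) (α x) / f x)) p.1 :=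
    h.mdifferentiableAt_const_mul_div_f d ε
  rw [h.leviCivita.cometric_curvature (h.smoothNear_scaledVlift hβ) (smoothNear_hlift hα),
    mvfderiv_congr_of_eventuallyEq e1, mvfderiv_congr_of_eventuallyEq e3, mvfderiv_const,
    mvfderiv_comp_fst d', h.deriv_ss hβ hβ, h.deriv_hh hα hα, h.deriv_hs hα hβ, h.deriv_sh hα hβ,
    h.bracket_sh hα hβ, D.apply_smul, h.op_vh hα, h.pair_self, hε.self_of_nhds, hlift_apply,
    warpedBivector_hcov, hcov_apply, dproj₁_hliftVec, h.mvfderiv_const_mul_div_f d,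
    h.mvfderiv_cometric_Jd hα, mvfderiv_anchor_apply h.metric₁ h.poisson₁]
  simp only [cometric_add_right, cometric_sub_left, cometric_sub_right, cometric_smul_left,
    cometric_smul_right, h.hh, h.hv, h.vv, zero_apply, h.cometric_vcov_scaledVlift,
    cometric_fieldEndo h.metric₂, normSq, h.pair_self, hε.self_of_nhds]
  rw [cometric_comm h.metric₁ p.1 (D₁.deriv α α p.1), cometric_comm h.metric₂ p.2 (β p.2) (fieldEndo g₂ P₂ p.2 _),
    cometric_fieldEndo h.metric₂, h.pair_self]
  field_simp
  ring

/-- Derivatives of `f ν g̃₂(𝒟_α β, γ)` along vertical lifts. -/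
lemma mvfderiv_deriv_ss {α β γ : OneForm I₂ M₂} (hα : α.SmoothNear p.2)
    (hβ : β.SmoothNear p.2) (hγ : γ.SmoothNear p.2)
    (ξ : Cotangent I₂ p.2) :
    mvfderiv (I₁.prod I₂) (fun q ↦ cometric (warpedMetric f g₁ g₂) q
        (D.deriv (scaledVlift f α) (scaledVlift f β) q) (scaledVlift f γ q)) p
        (warpedBivector ν P₁ P₂ p (vcov p ξ))
      = f p.1 * ν p.1 ^ 2 *
        mvfderiv I₂ (fun x ↦ cometric g₂ x (D₂.deriv α β x) (γ x)) p.2 (P₂ p.2 ξ) := by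
  have e : (fun q ↦ cometric (warpedMetric f g₁ g₂) q
        (D.deriv (scaledVlift f α) (scaledVlift f β) q) (scaledVlift f γ q))
      =ᶠ[𝓝 p] fun q ↦ (f q.1 * ν q.1) * cometric g₂ q.2 (D₂.deriv α β q.2) (γ q.2) := by
    filter_upwards [(continuousAt_snd (p := p)).eventually hα.eventually,
      (continuousAt_snd (p := p)).eventually hβ.eventually] with q h1 h2
    have hf := h.ne_zero q.1
    rw [h.deriv_ss h1 h2]
    simp only [cometric_add_left, cometric_sub_left, cometric_smul_left,
      h.cometric_vcov_scaledVlift, h.cometric_hcov_scaledVlift]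
    field_simp
    ring
  rw [mvfderiv_congr_of_eventuallyEq e, mvfderiv_fst_mul_snd
    (u := fun x ↦ f x * ν x) (w := fun x ↦ cometric g₂ x (D₂.deriv α β x) (γ x))
    ((h.mdifferentiableAt_f p.1).mul (h.mdifferentiableAt_ν p.1))
    (mdifferentiableAt_cometric h.metric₂ (h.leviCivita₂.smooth α β p.2 hα hβ) hγ),
    warpedBivector_vcov]
  simp only [add_apply, smul_apply, map_smul, hcov_apply, vcov_apply, dproj₁_vliftVec,
    dproj₂_vliftVec, map_zero, smul_eq_mul]
  ring

/-- The numerator of the sectional curvature of two orthogonal scaled vertical lifts. -/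
lemma cometric_curvature_ss {α β : OneForm I₂ M₂}
    (hα : α.SmoothNear p.2) (hβ : β.SmoothNear p.2)
    (hαβ : cometric g₂ p.2 (α p.2) (β p.2) = 0) :
    cometric (warpedMetric f g₁ g₂) p
        (curvature (warpedBivector ν P₁ P₂) D (scaledVlift f α) (scaledVlift f β)
          (scaledVlift f β) p) (scaledVlift f α p)
      = f p.1 ^ 2 * ν p.1 ^ 2 * cometric g₂ p.2 (curvature P₂ D₂ α β β p.2) (α p.2)
        - cometric g₂ p.2 (α p.2) (α p.2) * cometric g₂ p.2 (β p.2) (β p.2)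
          * normSq g₁ p.1 (Jd g₁ P₁ f p.1) / f p.1 ^ 2
        - 3 / 4 * f p.1 ^ 4 * P₂.pair p.2 (α p.2) (β p.2) ^ 2
          * normSq g₁ p.1 (mvfderiv I₁ ν p.1) := by
  have hf := h.ne_zero p.1
  rw [h.leviCivita.cometric_curvature (h.smoothNear_scaledVlift hα) (h.smoothNear_scaledVlift hβ),
    h.leviCivita₂.cometric_curvature hα hβ,
    scaledVlift_apply f α p, scaledVlift_apply f β p, map_smul, map_smul, map_smul, map_smul,
    h.mvfderiv_deriv_ss hβ hβ hα, h.mvfderiv_deriv_ss hα hβ hα, h.deriv_ss hβ hβ,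
    h.deriv_ss hα hα, h.deriv_ss hα hβ, h.deriv_ss hβ hα, h.bracket_ss hα hβ, D.apply_add, D.apply_smul,
    D.apply_smul, h.op_vs hβ, h.op_hs hβ, h.pair_self, h.pair_self, hαβ,
    cometric_comm h.metric₂ p.2 (β p.2) (α p.2), hαβ]
  simp only [cometric_add_left, cometric_add_right, cometric_sub_left, cometric_sub_right,
    cometric_smul_left, cometric_smul_right, h.hh, h.hv, h.vh, h.vv,
    cometric_fieldEndo h.metric₂, normSq, smul_eq_mul]
  rw [h.poisson₂.skew p.2 (β p.2) (α p.2)]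
  field_simp
  ring

end IsWarpedProduct
end WarpedSectional

section WarpedQualar

variable {E₁ : Type*} [NormedAddCommGroup E₁] [NormedSpace ℝ E₁] [FiniteDimensional ℝ E₁]
  {H₁ : Type*} [TopologicalSpace H₁] {I₁ : ModelWithCorners ℝ E₁ H₁}
  {M₁ : Type*} [TopologicalSpace M₁] [ChartedSpace H₁ M₁] [IsManifold I₁ ∞ M₁]
  {E₂ : Type*} [NormedAddCommGroup E₂] [NormedSpace ℝ E₂] [FiniteDimensional ℝ E₂]
  {H₂ : Type*} [TopologicalSpace H₂] {I₂ : ModelWithCorners ℝ E₂ H₂}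
  {M₂ : Type*} [TopologicalSpace M₂] [ChartedSpace H₂ M₂] [IsManifold I₂ ∞ M₂]
  [I₁.Boundaryless] [I₂.Boundaryless]

namespace IsWarpedProduct

variable {f ν : M₁ → ℝ} {g₁ : BilinField I₁ M₁} {g₂ : BilinField I₂ M₂}
  {P₁ : Anchor I₁ M₁} {P₂ : Anchor I₂ M₂} {D₁ : ContraOp I₁ M₁} {D₂ : ContraOp I₂ M₂}
  {D : ContraOp (I₁.prod I₂) (M₁ × M₂)}
  (h : IsWarpedProduct f ν g₁ g₂ P₁ P₂ D₁ D₂ D) {p : M₁ × M₂}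
include h

lemma sectionalCurvature_hs {α : OneForm I₁ M₁} {β : OneForm I₂ M₂}
    (hα : α.SmoothNear p.1) (hβ : β.SmoothNear p.2)
    (hα1 : cometric g₁ p.1 (α p.1) (α p.1) = -1)
    (hβ1 : ∀ᶠ y in 𝓝 p.2, cometric g₂ y (β y) (β y) = 1) :
    sectionalCurvature (warpedMetric f g₁ g₂) (warpedBivector ν P₁ P₂) D (hlift α)
        (scaledVlift f β) p
      = hessian g₁ P₁ D₁ f α α p.1 / f p.1
        + 2 * cometric g₁ p.1 (Jd g₁ P₁ f p.1) (α p.1) ^ 2 / f p.1 ^ 2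
        - f p.1 ^ 4 / 4 * cometric g₁ p.1 (mvfderiv I₁ ν p.1) (α p.1) ^ 2
          * normSq g₂ p.2 (fieldEndo g₂ P₂ p.2 (β p.2)) := by
  rw [sectionalCurvature, h.cometric_curvature_hs hα hβ hβ1, h.cometric_scaledVlift,
    hβ1.self_of_nhds, hlift_apply, h.hh, h.cometric_hcov_scaledVlift, hα1]
  ring

lemma sectionalCurvature_sh {α : OneForm I₁ M₁} {β : OneForm I₂ M₂}
    (hα : α.SmoothNear p.1) (hβ : β.SmoothNear p.2)
    (hα1 : cometric g₁ p.1 (α p.1) (α p.1) = 1)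
    (hβ1 : ∀ᶠ y in 𝓝 p.2, cometric g₂ y (β y) (β y) = -1) :
    sectionalCurvature (warpedMetric f g₁ g₂) (warpedBivector ν P₁ P₂) D
        (scaledVlift f β) (hlift α) p
      = -(hessian g₁ P₁ D₁ f α α p.1 / f p.1)
        - 2 * cometric g₁ p.1 (Jd g₁ P₁ f p.1) (α p.1) ^ 2 / f p.1 ^ 2
        - f p.1 ^ 4 / 4 * cometric g₁ p.1 (mvfderiv I₁ ν p.1) (α p.1) ^ 2
          * normSq g₂ p.2 (fieldEndo g₂ P₂ p.2 (β p.2)) := by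
  have e : cometric (warpedMetric f g₁ g₂) p (scaledVlift f β p) (hlift α p) = 0 := by
    rw [scaledVlift_apply, hlift_apply, cometric_smul_left, h.vh, mul_zero]
  rw [sectionalCurvature, h.cometric_curvature_sh hα hβ hβ1, h.cometric_scaledVlift,
    hβ1.self_of_nhds, e, hlift_apply, h.hh, hα1]
  ring

lemma sectionalCurvature_ss {α β : OneForm I₂ M₂}
    (hα : α.SmoothNear p.2) (hβ : β.SmoothNear p.2)
    (hα1 : cometric g₂ p.2 (α p.2) (α p.2) = -1) (hβ1 : cometric g₂ p.2 (β p.2) (β p.2) = 1)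
    (hαβ : cometric g₂ p.2 (α p.2) (β p.2) = 0) :
    sectionalCurvature (warpedMetric f g₁ g₂) (warpedBivector ν P₁ P₂) D
        (scaledVlift f α) (scaledVlift f β) p
      = f p.1 ^ 2 * ν p.1 ^ 2 * sectionalCurvature g₂ P₂ D₂ α β p.2
        + 3 * f p.1 ^ 4 * normSq g₁ p.1 (mvfderiv I₁ ν p.1) / 4
          * cometric g₂ p.2 (fieldEndo g₂ P₂ p.2 (α p.2)) (β p.2) ^ 2
        - normSq g₁ p.1 (Jd g₁ P₁ f p.1) / f p.1 ^ 2 := by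
  rw [sectionalCurvature, h.cometric_curvature_ss hα hβ hαβ, h.cometric_scaledVlift,
    h.cometric_scaledVlift, h.cometric_scaledVlift, sectionalCurvature, hα1, hβ1, hαβ,
    cometric_fieldEndo h.metric₂]
  ring

lemma laplacian_eq {k : ℕ} {θ : Fin k → OneForm I₁ M₁} {x : M₁}
    (hθ : ∀ i, (θ i).SmoothNear x) :
    laplacian P₁ D₁ θ f x = ∑ i, hessian g₁ P₁ D₁ f (θ i) (θ i) x := by
  rw [laplacian, ← Finset.sum_neg_distrib]
  exact Finset.sum_congr rfl fun i _ ↦ by rw [h.secondDeriv_eq (hθ i), neg_neg]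

end IsWarpedProduct

lemma sum_timelikeIdx_add_sum_spacelikeIdx {k : ℕ} (q : ℕ) (u : Fin k → ℝ) :
    ∑ i, u i = ∑ i ∈ timelikeIdx k q, u i + ∑ i ∈ spacelikeIdx k q, u i := by
  rw [timelikeIdx, spacelikeIdx, ← Finset.sum_filter_add_sum_filter_not _ fun i : Fin k ↦ i.val < q]
  simp only [not_lt]

lemma card_timelikeIdx {k q : ℕ} (hq : q ≤ k) : ((timelikeIdx k q).card : ℝ) = q := by
  rw [timelikeIdx, Fin.card_filter_val_lt, min_eq_right hq]

lemma card_spacelikeIdx {k q : ℕ} (hq : q ≤ k) : ((spacelikeIdx k q).card : ℝ) = k - q := by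
  have e := sum_timelikeIdx_add_sum_spacelikeIdx q fun _ : Fin k ↦ (1 : ℝ)
  simp only [Finset.sum_const, nsmul_eq_mul, mul_one, Finset.card_univ, Fintype.card_fin,
    card_timelikeIdx hq] at e
  linarith

namespace IsWarpedProduct

variable {f ν : M₁ → ℝ} {g₁ : BilinField I₁ M₁} {g₂ : BilinField I₂ M₂}
  {P₁ : Anchor I₁ M₁} {P₂ : Anchor I₂ M₂} {D₁ : ContraOp I₁ M₁} {D₂ : ContraOp I₂ M₂}
  {D : ContraOp (I₁.prod I₂) (M₁ × M₂)}

/-- The qualar curvature of a contravariant warped product. -/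
theorem qualarCurvature_eq (h : IsWarpedProduct f ν g₁ g₂ P₁ P₂ D₁ D₂ D) {p : M₁ × M₂}
    {k₁ k₂ q₁ q₂ : ℕ} (hq₂ : q₂ ≤ k₂)
    {dx : Fin k₁ → OneForm I₁ M₁} (hdx : IsOrthonormalCoframe g₁ q₁ dx p.1)
    {dy : Fin k₂ → OneForm I₂ M₂} (hdy : IsOrthonormalCoframe g₂ q₂ dy p.2) :
    qualarCurvature (warpedMetric f g₁ g₂) (warpedBivector ν P₁ P₂) D q₁ q₂
        (fun i ↦ hlift (dx i)) (fun j ↦ scaledVlift f (dy j)) p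
      = 2 * ∑ i ∈ timelikeIdx k₁ q₁, ∑ s ∈ spacelikeIdx k₁ q₁,
            sectionalCurvature g₁ P₁ D₁ (dx i) (dx s) p.1
        + 2 * (f p.1 ^ 2 * ν p.1 ^ 2) * ∑ i ∈ timelikeIdx k₂ q₂, ∑ s ∈ spacelikeIdx k₂ q₂,
            sectionalCurvature g₂ P₂ D₂ (dy i) (dy s) p.2
        + 3 * f p.1 ^ 4 * normSq g₁ p.1 (mvfderiv I₁ ν p.1) / 2 *
            ∑ i ∈ timelikeIdx k₂ q₂, ∑ s ∈ spacelikeIdx k₂ q₂,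
              |cometric g₂ p.2 (fieldEndo g₂ P₂ p.2 (dy i p.2)) (dy s p.2)| ^ 2
        - 2 * q₂ / f p.1 * laplacian P₁ D₁ dx f p.1
        + 2 * k₂ / f p.1 * ∑ i ∈ timelikeIdx k₁ q₁, hessian g₁ P₁ D₁ f (dx i) (dx i) p.1
        - 4 * q₂ / f p.1 ^ 2 * ∑ i, |cometric g₁ p.1 (Jd g₁ P₁ f p.1) (dx i p.1)| ^ 2
        + 4 * k₂ / f p.1 ^ 2 * ∑ i ∈ timelikeIdx k₁ q₁,
            |cometric g₁ p.1 (Jd g₁ P₁ f p.1) (dx i p.1)| ^ 2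
        - ∑ i ∈ timelikeIdx k₁ q₁, ∑ s ∈ spacelikeIdx k₂ q₂, f p.1 ^ 4 / 2 *
            |cometric g₁ p.1 (mvfderiv I₁ ν p.1) (dx i p.1)| ^ 2 *
            normSq g₂ p.2 (fieldEndo g₂ P₂ p.2 (dy s p.2))
        - 2 * ∑ _i ∈ timelikeIdx k₂ q₂, ∑ _s ∈ spacelikeIdx k₂ q₂,
            normSq g₁ p.1 (Jd g₁ P₁ f p.1) / f p.1 ^ 2
        - ∑ s ∈ timelikeIdx k₂ q₂, ∑ i ∈ spacelikeIdx k₁ q₁, f p.1 ^ 4 / 2 *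
            |cometric g₁ p.1 (mvfderiv I₁ ν p.1) (dx i p.1)| ^ 2 *
            normSq g₂ p.2 (fieldEndo g₂ P₂ p.2 (dy s p.2)) := by
  have tl : ∀ {k q : ℕ} {i : Fin k}, i ∈ timelikeIdx k q → i.val < q := fun hi ↦ by
    simpa [timelikeIdx] using hi
  have sl : ∀ {k q : ℕ} {i : Fin k}, i ∈ spacelikeIdx k q → q ≤ i.val := fun hi ↦ by
    simpa [spacelikeIdx] using hi
  have S₁ : ∑ i ∈ timelikeIdx k₁ q₁, ∑ s ∈ spacelikeIdx k₁ q₁,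
      sectionalCurvature (warpedMetric f g₁ g₂) (warpedBivector ν P₁ P₂) D
        (hlift (dx i)) (hlift (dx s)) p = _ :=
    Finset.sum_congr rfl fun i _ ↦ Finset.sum_congr rfl fun s _ ↦
      h.sectionalCurvature_hh (hdx.smooth i) (hdx.smooth s)
  have S₂ : ∑ i ∈ timelikeIdx k₁ q₁, ∑ s ∈ spacelikeIdx k₂ q₂,
      sectionalCurvature (warpedMetric f g₁ g₂) (warpedBivector ν P₁ P₂) D
        (hlift (dx i)) (scaledVlift f (dy s)) p = _ :=
    Finset.sum_congr rfl fun i hi ↦ Finset.sum_congr rfl fun s hs ↦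
      h.sectionalCurvature_hs (hdx.smooth i) (hdy.smooth s)
        (hdx.timelike i (tl hi)).self_of_nhds (hdy.spacelike s (sl hs))
  have S₃ : ∑ i ∈ timelikeIdx k₂ q₂, ∑ s ∈ spacelikeIdx k₁ q₁,
      sectionalCurvature (warpedMetric f g₁ g₂) (warpedBivector ν P₁ P₂) D
        (scaledVlift f (dy i)) (hlift (dx s)) p = _ :=
    Finset.sum_congr rfl fun i hi ↦ Finset.sum_congr rfl fun s hs ↦
      h.sectionalCurvature_sh (hdx.smooth s) (hdy.smooth i)
        (hdx.spacelike s (sl hs)).self_of_nhds (hdy.timelike i (tl hi))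
  have S₄ : ∑ i ∈ timelikeIdx k₂ q₂, ∑ s ∈ spacelikeIdx k₂ q₂,
      sectionalCurvature (warpedMetric f g₁ g₂) (warpedBivector ν P₁ P₂) D
        (scaledVlift f (dy i)) (scaledVlift f (dy s)) p = _ :=
    Finset.sum_congr rfl fun i hi ↦ Finset.sum_congr rfl fun s hs ↦
      h.sectionalCurvature_ss (hdy.smooth i) (hdy.smooth s)
        (hdy.timelike i (tl hi)).self_of_nhds (hdy.spacelike s (sl hs)).self_of_nhds
        (hdy.orthogonal i s fun e ↦ by
          have := tl hi
          have := sl hs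
          rw [e] at *
          omega).self_of_nhds
  rw [qualarCurvature, S₁, S₂, S₃, S₄, h.laplacian_eq hdx.smooth,
    sum_timelikeIdx_add_sum_spacelikeIdx q₁, sum_timelikeIdx_add_sum_spacelikeIdx q₁]
  simp only [sq_abs, Finset.sum_add_distrib, Finset.sum_sub_distrib, Finset.sum_neg_distrib,
    Finset.sum_const, ← Finset.sum_div, ← Finset.mul_sum, ← Finset.sum_mul, nsmul_eq_mul,
    card_timelikeIdx hq₂, card_spacelikeIdx hq₂]
  ring

end IsWarpedProduct
end WarpedQualar

end ContravariantGeometry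

end

theorem theorem4p3 {k₁ k₂ q₁ q₂ : ℕ} (hq₁ : q₁ ≤ k₁) (hq₂ : q₂ ≤ k₂)
    {M₁ : Type*} [TopologicalSpace M₁] [T2Space M₁] [SecondCountableTopology M₁]
    [ChartedSpace (EuclideanSpace ℝ (Fin k₁)) M₁] [IsManifold (𝓡 k₁) ∞ M₁]
    {M₂ : Type*} [TopologicalSpace M₂] [T2Space M₂] [SecondCountableTopology M₂]
    [ChartedSpace (EuclideanSpace ℝ (Fin k₂)) M₂] [IsManifold (𝓡 k₂) ∞ M₂]
    (g₁ : BilinField (𝓡 k₁) M₁) (hg₁ : IsPseudoRiemannian g₁)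
    (g₂ : BilinField (𝓡 k₂) M₂) (hg₂ : IsPseudoRiemannian g₂)
    (P₁ : Anchor (𝓡 k₁) M₁) (hP₁ : IsPoisson P₁)
    (P₂ : Anchor (𝓡 k₂) M₂) (hP₂ : IsPoisson P₂)
    (f₁ ν₁ : M₁ → ℝ) (hf₁ : ContMDiff (𝓡 k₁) 𝓘(ℝ, ℝ) ∞ f₁) (hf₁_pos : ∀ x, 0 < f₁ x)
    (hν₁ : ContMDiff (𝓡 k₁) 𝓘(ℝ, ℝ) ∞ ν₁)
    -- the contravariant Levi-Civita connections of `M₁`, of `M₂` and of the warped product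
    (D₁ : ContraOp (𝓡 k₁) M₁) (hD₁ : IsLeviCivita g₁ P₁ D₁)
    (D₂ : ContraOp (𝓡 k₂) M₂) (hD₂ : IsLeviCivita g₂ P₂ D₂)
    (D : ContraOp ((𝓡 k₁).prod (𝓡 k₂)) (M₁ × M₂))
    (hD : IsLeviCivita (warpedMetric f₁ g₁ g₂) (warpedBivector ν₁ P₁ P₂) D)
    (p : M₁ × M₂)
    (dx : Fin k₁ → OneForm (𝓡 k₁) M₁) (hdx : IsOrthonormalCoframe g₁ q₁ dx p.1)
    (dy : Fin k₂ → OneForm (𝓡 k₂) M₂) (hdy : IsOrthonormalCoframe g₂ q₂ dy p.2) :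
    qualarCurvature (warpedMetric f₁ g₁ g₂) (warpedBivector ν₁ P₁ P₂) D q₁ q₂
        (fun i ↦ hlift (dx i)) (fun j ↦ scaledVlift f₁ (dy j)) p
      = 2 * ∑ i ∈ timelikeIdx k₁ q₁, ∑ s ∈ spacelikeIdx k₁ q₁,
            sectionalCurvature g₁ P₁ D₁ (dx i) (dx s) p.1
        + 2 * (f₁ p.1 ^ 2 * ν₁ p.1 ^ 2) * ∑ i ∈ timelikeIdx k₂ q₂, ∑ s ∈ spacelikeIdx k₂ q₂,
            sectionalCurvature g₂ P₂ D₂ (dy i) (dy s) p.2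
        + 3 * f₁ p.1 ^ 4 * normSq g₁ p.1 (mvfderiv (𝓡 k₁) ν₁ p.1) / 2 *
            ∑ i ∈ timelikeIdx k₂ q₂, ∑ s ∈ spacelikeIdx k₂ q₂,
              |cometric g₂ p.2 (fieldEndo g₂ P₂ p.2 (dy i p.2)) (dy s p.2)| ^ 2
        - 2 * q₂ / f₁ p.1 * laplacian P₁ D₁ dx f₁ p.1
        + 2 * k₂ / f₁ p.1 * ∑ i ∈ timelikeIdx k₁ q₁, hessian g₁ P₁ D₁ f₁ (dx i) (dx i) p.1
        - 4 * q₂ / f₁ p.1 ^ 2 * ∑ i, |cometric g₁ p.1 (Jd g₁ P₁ f₁ p.1) (dx i p.1)| ^ 2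
        + 4 * k₂ / f₁ p.1 ^ 2 * ∑ i ∈ timelikeIdx k₁ q₁,
            |cometric g₁ p.1 (Jd g₁ P₁ f₁ p.1) (dx i p.1)| ^ 2
        - ∑ i ∈ timelikeIdx k₁ q₁, ∑ s ∈ spacelikeIdx k₂ q₂, f₁ p.1 ^ 4 / 2 *
            |cometric g₁ p.1 (mvfderiv (𝓡 k₁) ν₁ p.1) (dx i p.1)| ^ 2 *
            normSq g₂ p.2 (fieldEndo g₂ P₂ p.2 (dy s p.2))
        - 2 * ∑ _i ∈ timelikeIdx k₂ q₂, ∑ _s ∈ spacelikeIdx k₂ q₂,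
            normSq g₁ p.1 (Jd g₁ P₁ f₁ p.1) / f₁ p.1 ^ 2
        - ∑ s ∈ timelikeIdx k₂ q₂, ∑ i ∈ spacelikeIdx k₁ q₁, f₁ p.1 ^ 4 / 2 *
            |cometric g₁ p.1 (mvfderiv (𝓡 k₁) ν₁ p.1) (dx i p.1)| ^ 2 *
            normSq g₂ p.2 (fieldEndo g₂ P₂ p.2 (dy s p.2)) := by
  exact IsWarpedProduct.qualarCurvature_eq ⟨hg₁, hg₂, hP₁, hP₂, hf₁, fun x ↦ (hf₁_pos x).ne', hν₁,
    hD₁, hD₂, hD⟩ hq₂ hdx hdy
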